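/- **Setting.** Let $\mathcal S,\mathcal A$ be finite sets ($\mathcal A\neq\emptyset$), $P$ a transition kernel, $\rho$ an initial distribution with $\rho(s)\ge\rho_{\min}>0$ for all $s$, and $\gamma\in(0,1)$. For a stationary policy $\pi$ let $\lambda^\pi\in\mathbb R^{\mathcal S\times\mathcal A}$, $\lambda^\pi(s,a)=\sum_{t\ge0}\gamma^t\,\mathbb P_{\rho,\pi}(s_t=s,a_t=a)$, let $\lambda^\pi_H$ be the same sum over $t<H$, and let $\Lambda=\{\lambda^\pi\}$ over all stationary policies. Let $\pi_\theta(a|s)\propto\exp\psi(s,a;\theta)$, $\theta\in\mathbb R^d$, $\lambda(\theta)=\lambda^{\pi_\theta}$, let $\phi:\mathcal S\times\mathcal A\to\mathbb R^m$ be a feature map, $V=\{\langle\phi(\cdot),\omega\rangle:\omega\in\mathbb R^m\}$, and $F:\mathbb R^{\mathcal S\times\mathcal A}\to\mathbb R$. Put $L_\theta(\omega)=\mathbb E_{s\sim\rho,a\sim\mathcal U(\mathcal A)}[(\lambda_H^{\pi_\theta}(s,a)-\langle\phi(s,a),\omega\rangle)^2]$, $\omega_*(\theta)\in\arg\min L_\theta$,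 and, for a trajectory $\tau=(s_0,a_0,\dots,s_{H-1},a_{H-1})$, $g(\tau,\theta,r)=\sum_{t<H}\big(\sum_{t\le h<H}\gamma^h r(s_h,a_h)\big)\nabla\log\pi_\theta(a_t|s_t)$. **Assumptions.** (1) $\psi(s,a;\cdot)$ is $C^2$ with $\|\nabla\psi\|\le l_\psi$, $\|\nabla^2\psi\|\le L_\psi$. (2) $F$ is differentiable at the points of $\Lambda\cup V$; $\|\nabla F\|_\infty\le l_\lambda$ on $\Lambda$; and for all $\lambda,\lambda'\in\Lambda\cup V$, $\|\nabla F(\lambda)-\nabla F(\lambda')\|_\infty\le L_\lambda\|\lambda-\lambda'\|_2$ and $\|\nabla F(\lambda)-\nabla F(\lambda')\|_\infty\le L_{\lambda,\infty}\|\lambda-\lambda'\|_1$. (3) $\|\phi(s,a)\|\le B$ and $\mathbb E_{s\sim\rho,a\sim\mathcal U(\mathcal A)}[\phi(s,a)\phi(s,a)^T]\succcurlyeq\mu I$. All of $l_\psi,L_\psi,l_\lambda,L_\lambda,L_{\lambda,\infty},B,\mu$ are positive. (4) $F(\lambda(\theta))\le F(\lambda(\theta_0))+\Delta$ for all $\theta$.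 **Algorithm.** Regression subroutine for $\theta$: from $\omega_0=0$, for $k<K$ draw $s\sim\rho$, $a\sim\mathcal U(\mathcal A)$ and an independent trajectory $(s_h,a_h)_{h<H}$ of $\pi_\theta$, and set $\omega_{k+1}=\omega_k-2\beta\big(\langle\phi(s,a),\omega_k\rangle-\sum_{h<H}\gamma^h\mathbf 1\{(s_h,a_h)=(s,a)\}\big)\phi(s,a)$ with $\beta=1/(8B^2)$; return $\hat\omega_\theta=\frac1K\sum_{k=1}^K\omega_k$. Main method: $r_{-1}=\nabla F(\langle\phi(\cdot),\hat\omega_{\theta_0}\rangle)$; for $t=0,1,\dots,T-1$ run the subroutine afresh at $\theta_t$, put $r_t=\nabla F(\langle\phi(\cdot),\hat\omega_{\theta_t}\rangle)$, draw $N$ independent trajectories $\tau_t^{(i)}$ of length $H$ of $\pi_{\theta_t}$, and set $\theta_{t+1}=\theta_t+\frac\alpha N\sum_{i=1}^N g(\tau_t^{(i)},\theta_t,r_{t-1})$. Let $\bar\theta_T$ be uniform on $\{\theta_1,\dots,\theta_T\}$. **Claim.** There are $\alpha_0,c_H>0$, depending only on $\gamma,l_\psi,L_\psi,l_\lambda,L_\lambda,L_{\lambda,\infty}$,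 such that for every step size $0<\alpha\le\alpha_0$ and all $c,c'>0$ there is $C>0$, depending only on these quantities and on $\alpha,|\mathcal A|,m,\rho_{\min},B,\mu,\Delta,c,c'$, with the following property. In every problem as above with these constants, $\theta\mapsto F(\lambda(\theta))$ is differentiable and, for every $\varepsilon>0$ and all integers $T,N,K,H\ge1$ with $T,N,K\ge c\,\varepsilon^{-2}$ and $H\ge c_H\log(1/\varepsilon)$: (a) if $\mathbb E[L_{\theta_t}(\omega_*(\theta_t))]\le\varepsilon_{\rm approx}$ for all $0\le t<T$, then $$\mathbb E\,\|\nabla_\theta F(\lambda(\bar\theta_T))\|\le C\varepsilon+C\sqrt{\varepsilon_{\rm approx}};$$ (b) if moreover $\varepsilon\le\frac12$, $T,N,K\le c'\varepsilon^{-2}$ and $H\le c'\log(1/\varepsilon)$ (so that $T,N,K=O(\varepsilon^{-2})$ and $H=O(\log\frac1\varepsilon)$), then $T(K+N)H\le C\varepsilon^{-4}\log(1/\varepsilon)$, and the total number of state-action pairs sampled by the method is, in every run, at most $C\varepsilon^{-4}\log(1/\varepsilon)$, i.e. $\tilde O(\varepsilon^{-4})$. -/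

import Mathlib

open MeasureTheory

namespace GenUtilityRL

noncomputable section

/-- `ℝ^n` with its Euclidean norm. -/
abbrev E (n : ℕ) : Type := EuclideanSpace ℝ (Fin n)

/-- The data of the problem: a discounted MDP with finite state space `S` and action space `A`
(transition kernel `P`, initial distribution `ρ`, discount factor `γ`), a utility `F` of the
occupancy measure, seen as a vector of `ℝ^(S × A)`, the function `ψ` that defines the softmax
parametrization by `θ ∈ ℝ^d`, and a feature map `φ` with values in `ℝ^m`. -/
structure Problem (S A : Type*) [Fintype S] [Fintype A] (d m : ℕ) where
  P : S → A → PMF S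
  ρ : PMF S
  γ : ℝ
  F : EuclideanSpace ℝ (S × A) → ℝ
  ψ : S → A → E d → ℝ
  φ : S × A → E m

/-- `π_θ(a|s) = exp ψ(s,a;θ) / ∑_{a'} exp ψ(s,a';θ)`. -/
def softmaxProb {A : Type*} [Fintype A] (v : A → ℝ) (a : A) : ℝ :=
  Real.exp (v a) / ∑ a' : A, Real.exp (v a')

theorem softmaxProb_sum {A : Type*} [Fintype A] [Nonempty A] (v : A → ℝ) :
    ∑ a : A, ENNReal.ofReal (softmaxProb v a) = 1 := by
  have hpos : 0 < ∑ a' : A, Real.exp (v a') :=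
    Finset.sum_pos (fun a _ => Real.exp_pos _) Finset.univ_nonempty
  simp only [softmaxProb]
  rw [← ENNReal.ofReal_sum_of_nonneg
    (fun a _ => div_nonneg (Real.exp_pos _).le hpos.le)]
  rw [← Finset.sum_div, div_self hpos.ne', ENNReal.ofReal_one]

/-- The softmax distribution on `A`. -/
def softmax {A : Type*} [Fintype A] [Nonempty A] (v : A → ℝ) : PMF A :=
  PMF.ofFintype (fun a => ENNReal.ofReal (softmaxProb v a)) (softmaxProb_sum v)

/-- One state of the averaged SGD recursion: the iterate `ω_k`, the sum `ω_1 + ⋯ + ω_k`, and the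
number of state-action pairs sampled so far. -/
structure SGDState (m : ℕ) where
  iterate : E m
  total : E m
  samples : ℕ

/-- One state of the policy gradient method: `θ_t`, the vector `r_{t-1}`, and the number of
state-action pairs sampled so far. -/
structure PGState (S A : Type*) [Fintype S] [Fintype A] (d : ℕ) where
  θ : E d
  r : EuclideanSpace ℝ (S × A)
  samples : ℕ

/-- `n` independent draws from `p`. -/
def iid {X : Type*} (p : PMF X) : (n : ℕ) → PMF (Fin n → X)
  | 0 => PMF.pure Fin.elim0
  | n + 1 => (iid p n).bind fun x => p.bind fun y => PMF.pure (Fin.snoc x y)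

namespace Problem

variable {S A : Type*} [Fintype S] [Fintype A] [DecidableEq S] [DecidableEq A] [Nonempty A]
  {d m : ℕ}

/-- The distribution of the next state after a trajectory `(s_0, a_0, …, s_{n-1}, a_{n-1})`. -/
def nextState (M : Problem S A d m) : {n : ℕ} → (Fin n → S × A) → PMF S
  | 0, _ => M.ρ
  | n + 1, τ => M.P (τ (Fin.last n)).1 (τ (Fin.last n)).2

/-- The law of the trajectory `(s_0, a_0, …, s_{H-1}, a_{H-1})` of length `H` generated from the
initial distribution by the stationary policy `π`. -/
def trajLaw (M : Problem S A d m) (π : S → PMF A) : (H : ℕ) → PMF (Fin H → S × A)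
  | 0 => PMF.pure Fin.elim0
  | H + 1 => (M.trajLaw π H).bind fun τ => (M.nextState τ).bind fun s => (π s).bind fun a =>
      PMF.pure (Fin.snoc τ (s, a))

/-- The law of `(s_t, a_t)` under the policy `π`. -/
def pairLaw (M : Problem S A d m) (π : S → PMF A) (t : ℕ) : PMF (S × A) :=
  (M.trajLaw π (t + 1)).map fun τ => τ (Fin.last t)

/-- The occupancy measure `λ^π(s,a) = ∑_{t ≥ 0} γ^t ℙ(s_t = s, a_t = a)`. -/
def occ (M : Problem S A d m) (π : S → PMF A) : EuclideanSpace ℝ (S × A) :=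
  WithLp.toLp 2 fun p => ∑' t : ℕ, M.γ ^ t * (M.pairLaw π t p).toReal

/-- The truncated occupancy measure `λ_H^π(s,a) = ∑_{t < H} γ^t ℙ(s_t = s, a_t = a)`. -/
def occTrunc (M : Problem S A d m) (H : ℕ) (π : S → PMF A) : EuclideanSpace ℝ (S × A) :=
  WithLp.toLp 2 fun p => ∑ t ∈ Finset.range H, M.γ ^ t * (M.pairLaw π t p).toReal

/-- The softmax policy `π_θ`. -/
def policy (M : Problem S A d m) (θ : E d) : S → PMF A :=
  fun s => softmax fun a => M.ψ s a θ

/-- The objective `θ ↦ F(λ(θ))`, where `λ(θ)` is the occupancy measure of `π_θ`. -/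
def objective (M : Problem S A d m) (θ : E d) : ℝ := M.F (M.occ (M.policy θ))

/-- `∇_θ log π_θ(a|s)`. -/
def score (M : Problem S A d m) (θ : E d) (s : S) (a : A) : E d :=
  gradient (fun θ' : E d => Real.log (softmaxProb (fun a' => M.ψ s a' θ') a)) θ

/-- The policy gradient estimate
`g(τ,θ,r) = ∑_{t<H} (∑_{t ≤ h < H} γ^h r(s_h,a_h)) ∇ log π_θ(a_t|s_t)`. -/
def pgEstimate (M : Problem S A d m) {H : ℕ} (τ : Fin H → S × A) (θ : E d)
    (r : EuclideanSpace ℝ (S × A)) : E d :=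
  ∑ t : Fin H, (∑ h ∈ Finset.Ici t, M.γ ^ (h : ℕ) * r (τ h)) • M.score θ (τ t).1 (τ t).2

/-- The Monte Carlo estimate `∑_{h<H} γ^h 1{(s_h,a_h) = (s,a)}` of `λ_H(s,a)` from a
trajectory. -/
def mcOcc (M : Problem S A d m) {H : ℕ} (τ : Fin H → S × A) (p : S × A) : ℝ :=
  ∑ h : Fin H, if τ h = p then M.γ ^ (h : ℕ) else 0

/-- The law of `(s,a)` with `s ∼ ρ` and `a` uniform on `A`, independent of `s`. -/
def queryLaw (M : Problem S A d m) : PMF (S × A) :=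
  M.ρ.bind fun s => (PMF.uniformOfFintype A).bind fun a => PMF.pure (s, a)

/-- The linear approximation `(s,a) ↦ ⟨φ(s,a), ω⟩`. -/
def linApprox (M : Problem S A d m) (ω : E m) : EuclideanSpace ℝ (S × A) :=
  WithLp.toLp 2 fun p => inner ℝ (M.φ p) ω

/-- The expected regression loss
`L_θ(ω) = 𝔼_{s ∼ ρ, a ∼ U(A)} [(λ_H^{π_θ}(s,a) - ⟨φ(s,a), ω⟩)^2]`. -/
def regLoss (M : Problem S A d m) (H : ℕ) (θ : E d) (ω : E m) : ℝ :=
  ∑ p : S × A, (M.queryLaw p).toReal *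
    (M.occTrunc H (M.policy θ) p - inner ℝ (M.φ p) ω) ^ 2

/-- The law of the state of the SGD recursion for the loss `L_θ` after `k` iterations. An
iteration draws a query `(s,a)` and an independent trajectory of length `H` of the policy `π_θ`. -/
def sgdLaw (M : Problem S A d m) (ω₀ : E m) (β : ℝ) (H : ℕ) (θ : E d) :
    (k : ℕ) → PMF (SGDState m)
  | 0 => PMF.pure ⟨ω₀, 0, 0⟩
  | k + 1 => (M.sgdLaw ω₀ β H θ k).bind fun x => M.queryLaw.bind fun p =>
      (M.trajLaw (M.policy θ) H).bind fun τ =>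
        let grad : E m := (2 * (inner ℝ (M.φ p) x.iterate - M.mcOcc τ p)) • M.φ p
        let ω : E m := x.iterate - β • grad
        PMF.pure ⟨ω, x.total + ω, x.samples + (H + 1)⟩

/-- The joint law of the output `(1/K) ∑_{k=1}^K ω_k` of the averaged SGD subroutine and of the
number of state-action pairs that it samples. -/
def sgdOutput (M : Problem S A d m) (ω₀ : E m) (β : ℝ) (K H : ℕ) (θ : E d) : PMF (E m × ℕ) :=
  (M.sgdLaw ω₀ β H θ K).map fun x => ((1 / (K : ℝ)) • x.total, x.samples)

/-- The law of the state of the stochastic policy gradient method with linear approximation of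
the occupancy measure after `t` iterations, started at `θ₀`, with step size `α`, batch size `N`,
horizon `H`, and `K` steps of averaged SGD (started at `ω₀`, with step size `β`) in each call of
the regression subroutine. -/
def pgLaw (M : Problem S A d m) (θ₀ : E d) (α : ℝ) (N : ℕ) (ω₀ : E m) (β : ℝ) (K H : ℕ) :
    (t : ℕ) → PMF (PGState S A d)
  | 0 => (M.sgdOutput ω₀ β K H θ₀).bind fun w =>
      PMF.pure ⟨θ₀, gradient M.F (M.linApprox w.1), w.2⟩
  | t + 1 => (M.pgLaw θ₀ α N ω₀ β K H t).bind fun x =>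
      (M.sgdOutput ω₀ β K H x.θ).bind fun w =>
        (iid (M.trajLaw (M.policy x.θ) H) N).bind fun τ =>
          PMF.pure ⟨x.θ + (α / (N : ℝ)) • ∑ i : Fin N, M.pgEstimate (τ i) x.θ x.r,
            gradient M.F (M.linApprox w.1), x.samples + w.2 + N * H⟩

/-- The law of `θ_t`. -/
def iterateLaw (M : Problem S A d m) (θ₀ : E d) (α : ℝ) (N : ℕ) (ω₀ : E m) (β : ℝ) (K H : ℕ)
    (t : ℕ) : PMF (E d) :=
  (M.pgLaw θ₀ α N ω₀ β K H t).map PGState.θ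

/-- The law of `θ̄_T`, drawn uniformly at random from `{θ_1, …, θ_T}`. -/
def averageLaw (M : Problem S A d m) (θ₀ : E d) (α : ℝ) (N : ℕ) (ω₀ : E m) (β : ℝ) (K H : ℕ)
    (T : ℕ) (hT : 1 ≤ T) : PMF (E d) :=
  (PMF.uniformOfFinset (Finset.Icc 1 T) (Finset.nonempty_Icc.mpr hT)).bind
    fun t => M.iterateLaw θ₀ α N ω₀ β K H t

/-- The set `Λ` of the occupancy measures of all stationary policies. -/
def occSet (M : Problem S A d m) : Set (EuclideanSpace ℝ (S × A)) := Set.range M.occ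

/-- Regularity of the policy parametrization: every `ψ(s,a;·)` is twice continuously
differentiable, with gradient bounded by `lψ` and Hessian bounded by `Lψ` in spectral norm. -/
structure PolicyRegular (M : Problem S A d m) (lψ Lψ : ℝ) : Prop where
  contDiff : ∀ s a, ContDiff ℝ 2 (M.ψ s a)
  grad_le : ∀ s a θ, ‖gradient (M.ψ s a) θ‖ ≤ lψ
  hess_le : ∀ s a θ, ‖fderiv ℝ (gradient (M.ψ s a)) θ‖ ≤ Lψ

/-- Regularity of the utility: the gradient of `F` is bounded on `Λ` in sup norm by `lF`, and on
`Λ ∪ {⟨φ(·), ω⟩ : ω ∈ ℝ^m}` the function `F` is differentiable and its gradient is Lipschitz for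
the sup norm, with constant `LF` with respect to the Euclidean norm and with constant `LF₁` with
respect to the `ℓ¹`-norm. (The norm of `WithLp.ofLp x : S × A → ℝ` is the sup norm of `x`.) -/
structure UtilityRegular (M : Problem S A d m) (lF LF LF₁ : ℝ) : Prop where
  differentiableAt : ∀ x ∈ M.occSet ∪ Set.range M.linApprox, DifferentiableAt ℝ M.F x
  grad_le : ∀ x ∈ M.occSet, ‖WithLp.ofLp (gradient M.F x)‖ ≤ lF
  lipschitz_two : ∀ x ∈ M.occSet ∪ Set.range M.linApprox,
    ∀ y ∈ M.occSet ∪ Set.range M.linApprox,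
      ‖WithLp.ofLp (gradient M.F x - gradient M.F y)‖ ≤ LF * ‖x - y‖
  lipschitz_one : ∀ x ∈ M.occSet ∪ Set.range M.linApprox,
    ∀ y ∈ M.occSet ∪ Set.range M.linApprox,
      ‖WithLp.ofLp (gradient M.F x - gradient M.F y)‖ ≤ LF₁ * ∑ p : S × A, |x p - y p|

/-- The features are bounded by `B`, and their covariance
`𝔼_{s ∼ ρ, a ∼ U(A)} [φ(s,a) φ(s,a)ᵀ]` satisfies `⪰ μ I`. -/
structure FeatureRegular (M : Problem S A d m) (B μ : ℝ) : Prop where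
  norm_le : ∀ p, ‖M.φ p‖ ≤ B
  cov : ((∑ p : S × A, (M.queryLaw p).toReal •
    Matrix.vecMulVec (WithLp.ofLp (M.φ p)) (WithLp.ofLp (M.φ p)))
      - μ • (1 : Matrix (Fin m) (Fin m) ℝ)).PosSemidef

end Problem

end

end GenUtilityRL

open GenUtilityRL

/-! Write J(θ) = F(λ(θ)) and u_θ = ∇F(λ(θ)). Differentiating trajectory laws through their score
shows that ∇J(θ) is the ordinary policy gradient for the reward u_θ held fixed
(`hasGradientAt_objective`). This expression is linear and bounded in the reward, and ∇J is
Lipschitz in θ (`norm_gradient_objective_sub_le`). The estimate g(τ,θ,r) has as its mean the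
truncated policy gradient for r (`ex_pgEstimate`). Since r_{t-1} is fixed before the batch at time t
is drawn, the mean squared error of the batch average is at most W‖r - u_θ‖² plus a truncation term
of order γ^H and a variance term of order 1/N (`ex_estimate_sub_gradient_sq_le`).

For t ≥ 1 the reward is stale: r_{t-1} was fitted at θ_{t-1} and is used at θ_t. The potential D -
J(θ) + (W/2)α‖r - u_θ‖² deals with this. Its last term pays exactly for the reward error of the
current step. The staleness created by a move αg costs O(α³‖g‖²), and the curvature of J costs
O(α²‖g‖²). For small α both are absorbed by the term (α/2)‖g‖² in the polarization of α⟨∇J, g⟩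
(`potential_step_le`). Telescoping bounds the average of E‖∇J(θ_t)‖² by O(1/T), the batch error and
O(δ), where δ is the mean squared error of a freshly fitted reward (`sum_ex_norm_gradient_sq_le`).

The Lipschitz property of ∇F reduces δ to the error of the regression. Summing the SGD recursion
writes the covariance operator applied to ∑(ω_k - w) as a martingale plus a boundary term in the
last iterate, so the averaged iterate is within O(1/K) of the minimizer w in mean square
(`ex_average_sub_sq_le`). The query law gives each pair mass at least ρ_min/|A|, which turns
regression loss into Euclidean distance (`ex_sgdOutput_linApprox_sub_sq_le`). Jensen's inequality
and a square root give (a); for (b), the sample count is deterministic. -/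

namespace GenUtilityRL

noncomputable section

/-! ### Expectations under finitely supported laws -/

/-- Probability mass functions with finite support. -/
class FinSupp {X : Type*} (p : PMF X) : Prop where
  finite_support : p.support.Finite

/-- The expectation of `f` under `p`. -/
def ex {X V : Type*} [NormedAddCommGroup V] [NormedSpace ℝ V] (p : PMF X) (f : X → V) : V :=
  ∑' x, (p x).toReal • f x

section Expectation

variable {X Y V W : Type*} [NormedAddCommGroup V] [NormedSpace ℝ V]
  [NormedAddCommGroup W] [NormedSpace ℝ W]

instance (priority := 100) FinSupp.of_finite [Finite X] (p : PMF X) : FinSupp p :=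
  ⟨Set.toFinite _⟩

instance FinSupp.pure (x : X) : FinSupp (PMF.pure x) := ⟨by simp⟩

instance FinSupp.bind (p : PMF X) (q : X → PMF Y) [hp : FinSupp p] [hq : ∀ x, FinSupp (q x)] :
    FinSupp (p.bind q) :=
  ⟨by
    rw [PMF.support_bind]
    exact hp.finite_support.biUnion fun x _ => (hq x).finite_support⟩

instance FinSupp.map (p : PMF X) (g : X → Y) [hp : FinSupp p] : FinSupp (p.map g) :=
  ⟨by rw [PMF.support_map]; exact hp.finite_support.image _⟩

theorem summable_ex (p : PMF X) [hp : FinSupp p] (f : X → V) :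
    Summable fun x => (p x).toReal • f x := by
  refine summable_of_hasFiniteSupport (hp.finite_support.subset fun x hx => ?_)
  rw [PMF.mem_support_iff]
  intro h
  simp [h] at hx

theorem toReal_sum (p : PMF X) : ∑' x, (p x).toReal = 1 := by
  rw [← ENNReal.tsum_toReal_eq fun x => p.apply_ne_top x, p.tsum_coe, ENNReal.toReal_one]

theorem ex_eq_sum [Fintype X] (p : PMF X) (f : X → V) :
    ex p f = ∑ x, (p x).toReal • f x := by
  simp [ex, tsum_fintype]

theorem ex_pure (x : X) (f : X → V) : ex (PMF.pure x) f = f x := by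
  classical
  rw [ex, tsum_eq_single x]
  · simp
  · intro y hy
    simp [PMF.pure_apply, hy]

theorem ex_add (p : PMF X) [FinSupp p] (f g : X → V) :
    (ex p fun x => f x + g x) = ex p f + ex p g := by
  simp only [ex, smul_add]
  exact (summable_ex p f).tsum_add (summable_ex p g)

theorem ex_sub (p : PMF X) [FinSupp p] (f g : X → V) :
    (ex p fun x => f x - g x) = ex p f - ex p g := by
  simp only [ex, smul_sub]
  exact (summable_ex p f).tsum_sub (summable_ex p g)

theorem ex_clm (p : PMF X) [FinSupp p] (L : V →L[ℝ] W) (f : X → V) :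
    (ex p fun x => L (f x)) = L (ex p f) := by
  rw [ex, ex, L.map_tsum (summable_ex p f)]
  simp

theorem ex_const (p : PMF X) [FinSupp p] (v : V) : (ex p fun _ => v) = v := by
  have h : Summable fun x => (p x).toReal := by
    simpa using summable_ex p fun _ => (1 : ℝ)
  rw [ex, h.tsum_smul_const, toReal_sum, one_smul]

theorem ex_smul (p : PMF X) [FinSupp p] (c : ℝ) (f : X → V) :
    (ex p fun x => c • f x) = c • ex p f :=
  ex_clm p (c • ContinuousLinearMap.id ℝ V) f

theorem ex_mul (p : PMF X) [FinSupp p] (c : ℝ) (f : X → ℝ) :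
    (ex p fun x => c * f x) = c * ex p f := by
  simpa using ex_smul p c f

theorem ex_mono (p : PMF X) [FinSupp p] {f g : X → ℝ} (h : ∀ x, f x ≤ g x) :
    ex p f ≤ ex p g :=
  (summable_ex p f).tsum_le_tsum
    (fun x => mul_le_mul_of_nonneg_left (h x) ENNReal.toReal_nonneg) (summable_ex p g)

theorem ex_nonneg (p : PMF X) {f : X → ℝ} (h : ∀ x, 0 ≤ f x) : 0 ≤ ex p f :=
  tsum_nonneg fun x => mul_nonneg ENNReal.toReal_nonneg (h x)

theorem ex_le_const (p : PMF X) [FinSupp p] {f : X → ℝ} {c : ℝ} (h : ∀ x, f x ≤ c) :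
    ex p f ≤ c :=
  (ex_mono p h).trans_eq (ex_const p c)

theorem ex_congr (p : PMF X) {f g : X → V} (h : ∀ x, f x = g x) : ex p f = ex p g := by
  rw [funext h]

theorem norm_ex_le (p : PMF X) [FinSupp p] (f : X → V) : ‖ex p f‖ ≤ ex p fun x => ‖f x‖ := by
  have h : ∀ x, ‖(p x).toReal • f x‖ = (p x).toReal • ‖f x‖ := fun x => by
    rw [norm_smul, Real.norm_of_nonneg ENNReal.toReal_nonneg, smul_eq_mul]
  have hs : Summable fun x => ‖(p x).toReal • f x‖ := by
    simp only [h]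
    exact summable_ex p _
  refine (norm_tsum_le_tsum_norm hs).trans_eq ?_
  simp only [h, ex]

theorem norm_ex_le_const (p : PMF X) [FinSupp p] {f : X → V} {c : ℝ} (h : ∀ x, ‖f x‖ ≤ c) :
    ‖ex p f‖ ≤ c :=
  (norm_ex_le p f).trans (ex_le_const p h)

/-- The tower property. Finite support of `p` makes the outer sum finite, so it commutes with the
series over `Y`. This carries every conditioning argument below. -/
theorem ex_bind (p : PMF X) (q : X → PMF Y) [hp : FinSupp p] [∀ x, FinSupp (q x)] (f : Y → V) :
    ex (p.bind q) f = ex p fun x => ex (q x) f := by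
  have h0 : ∀ x ∉ hp.finite_support.toFinset, p x = 0 := fun x hx => by
    simpa [PMF.mem_support_iff] using hx
  have h1 : ∀ y, (p.bind q y).toReal =
      ∑ x ∈ hp.finite_support.toFinset, (p x).toReal * (q x y).toReal := fun y => by
    rw [PMF.bind_apply, tsum_eq_sum (s := hp.finite_support.toFinset)
      (fun x hx => by simp [h0 x hx]),
      ENNReal.toReal_sum fun x _ => ENNReal.mul_ne_top (p.apply_ne_top x) ((q x).apply_ne_top y)]
    simp
  rw [ex]
  simp only [h1, Finset.sum_smul, mul_smul]
  rw [Summable.tsum_finsetSum fun x _ => (summable_ex (q x) f).const_smul _, ex,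
    tsum_eq_sum (s := hp.finite_support.toFinset) (fun x hx => by simp [h0 x hx])]
  refine Finset.sum_congr rfl fun x _ => ?_
  rw [(summable_ex (q x) f).tsum_const_smul, ex]

theorem ex_map (p : PMF X) (g : X → Y) [FinSupp p] (f : Y → V) :
    ex (p.map g) f = ex p fun x => f (g x) := by
  have : ∀ x, FinSupp ((PMF.pure ∘ g) x) := fun x => FinSupp.pure (g x)
  rw [PMF.map, ex_bind]
  simp [ex_pure]

theorem sq_ex_le (p : PMF X) [FinSupp p] (f : X → ℝ) : ex p f ^ 2 ≤ ex p fun x => f x ^ 2 := by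
  have h := ex_nonneg p (f := fun x => (f x - ex p f) ^ 2) fun x => sq_nonneg _
  have h2 : (fun x => (f x - ex p f) ^ 2) =
      fun x => (f x ^ 2 - (2 * ex p f) * f x) + ex p f ^ 2 := by
    funext x; ring
  rw [h2, ex_add, ex_sub, ex_mul, ex_const] at h
  nlinarith

theorem ex_inner {V : Type*} [NormedAddCommGroup V] [InnerProductSpace ℝ V] (p : PMF X)
    [FinSupp p] (v : V) (f : X → V) :
    (ex p fun x => inner ℝ v (f x)) = inner ℝ v (ex p f) :=
  ex_clm p (innerSL ℝ v) f

/-- The second moment of `v + f` for a fixed vector `v` and a centered random vector `f`. -/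
theorem ex_norm_add_sq {V : Type*} [NormedAddCommGroup V] [InnerProductSpace ℝ V] (p : PMF X)
    [FinSupp p] (v : V) (f : X → V) (hf : ex p f = 0) :
    (ex p fun x => ‖v + f x‖ ^ 2) = ‖v‖ ^ 2 + ex p fun x => ‖f x‖ ^ 2 := by
  simp only [norm_add_sq_real]
  rw [ex_add, ex_add, ex_mul, ex_inner, hf, ex_const]
  simp

/-- Links the Bochner integrals of the main theorem to finite sums. On a finite set with measurable
points every function is integrable, so no measurability of `f` is needed. -/
theorem integral_toMeasure_eq_ex [MeasurableSpace X] [MeasurableSingletonClass X] (p : PMF X)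
    [hp : FinSupp p] (f : X → ℝ) : ∫ x, f x ∂p.toMeasure = ex p f := by
  have hi : Integrable f p.toMeasure := by
    rw [← PMF.restrict_toMeasure_support p]
    exact IntegrableOn.of_finite hp.finite_support
  rw [PMF.integral_eq_tsum _ _ hi, ex]

end Expectation

/-! ### Empirical means of independent samples -/

instance iid_finite {X : Type*} (p : PMF X) [FinSupp p] : ∀ n, FinSupp (iid p n)
  | 0 => FinSupp.pure _
  | n + 1 => by
    have := iid_finite p n
    unfold iid
    infer_instance

/-- The second moment of a sum of independent centered random vectors. -/
theorem ex_iid_norm_sum_sq {X V : Type*} [NormedAddCommGroup V] [InnerProductSpace ℝ V]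
    (p : PMF X) [FinSupp p] (f : X → V) (hf : ex p f = 0) (n : ℕ) :
    (ex (iid p n) fun x => ‖∑ i, f (x i)‖ ^ 2) = n * ex p fun x => ‖f x‖ ^ 2 := by
  induction n with
  | zero => simp [iid, ex_pure]
  | succ n ih =>
    have := iid_finite p n
    rw [iid, ex_bind]
    simp only [ex_bind, ex_pure, Fin.sum_univ_castSucc, Fin.snoc_castSucc, Fin.snoc_last]
    -- Given the first `n` draws, the last summand is centered, so the cross term vanishes.
    simp only [ex_norm_add_sq p _ f hf]
    rw [ex_add, ih, ex_const]
    push_cast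
    ring

/-- The mean squared error of an empirical mean as an estimate of `v`. -/
theorem ex_iid_norm_mean_sub_sq_le {X V : Type*} [NormedAddCommGroup V] [InnerProductSpace ℝ V]
    (p : PMF X) [FinSupp p] (f : X → V) (v : V) {n : ℕ} (hn : 1 ≤ n) :
    (ex (iid p n) fun x => ‖(1 / (n : ℝ)) • ∑ i, f (x i) - v‖ ^ 2) ≤
      2 * ‖ex p f - v‖ ^ 2 + 2 / n * ex p fun x => ‖f x‖ ^ 2 := by
  have := iid_finite p n
  have hn' : (0 : ℝ) < n := by exact_mod_cast hn
  have h0 : (ex p fun x => f x - ex p f) = 0 := by rw [ex_sub, ex_const, sub_self]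
  have h1 := ex_iid_norm_sum_sq p (fun x => f x - ex p f) h0 n
  have h2 : (ex p fun x => ‖f x - ex p f‖ ^ 2) ≤ ex p fun x => ‖f x‖ ^ 2 := by
    have := ex_norm_add_sq p (ex p f) (fun x => f x - ex p f) h0
    simp only [add_sub_cancel] at this
    rw [this]
    linarith [sq_nonneg ‖ex p f‖]
  have h3 : ∀ x : Fin n → X, ‖(1 / (n : ℝ)) • ∑ i, f (x i) - v‖ ^ 2 ≤
      2 * ‖ex p f - v‖ ^ 2 + 2 / n ^ 2 * ‖∑ i, (f (x i) - ex p f)‖ ^ 2 := fun x => by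
    have e : (1 / (n : ℝ)) • ∑ i, f (x i) - v =
        (ex p f - v) + (1 / (n : ℝ)) • ∑ i, (f (x i) - ex p f) := by
      rw [Finset.sum_sub_distrib, smul_sub, Finset.sum_const, Finset.card_univ, Fintype.card_fin,
        ← Nat.cast_smul_eq_nsmul ℝ, smul_smul, one_div, inv_mul_cancel₀ hn'.ne', one_smul]
      abel
    have e2 : ‖(1 / (n : ℝ)) • ∑ i, (f (x i) - ex p f)‖ ^ 2 =
        1 / n ^ 2 * ‖∑ i, (f (x i) - ex p f)‖ ^ 2 := by
      rw [norm_smul, mul_pow, Real.norm_of_nonneg (by positivity)]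
      ring
    rw [e]
    have := parallelogram_law_with_norm ℝ (ex p f - v) ((1 / (n : ℝ)) • ∑ i, (f (x i) - ex p f))
    rw [show 2 / (n : ℝ) ^ 2 = 2 * (1 / n ^ 2) by ring, mul_assoc, ← e2]
    nlinarith [sq_nonneg ‖(ex p f - v) - (1 / (n : ℝ)) • ∑ i, (f (x i) - ex p f)‖]
  refine (ex_mono _ h3).trans ?_
  rw [ex_add, ex_const, ex_mul, h1]
  have : 2 / (n : ℝ) ^ 2 * (n * ex p fun x => ‖f x - ex p f‖ ^ 2) =
      2 / n * ex p fun x => ‖f x - ex p f‖ ^ 2 := by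
    field_simp
  rw [this]
  gcongr

/-! ### Stochastic gradients of a least squares problem -/

section LeastSquares

variable {Z V : Type*} [NormedAddCommGroup V] [InnerProductSpace ℝ V]

/-- The second moment operator `v ↦ 𝔼 ⟨a, v⟩ a` of the random vector `a`. -/
def secondMoment (D : PMF Z) (a : Z → V) : V →L[ℝ] V :=
  ex D fun z => (innerSL ℝ (a z)).smulRight (a z)

theorem secondMoment_apply (D : PMF Z) [FinSupp D] (a : Z → V) (v : V) :
    secondMoment D a v = ex D fun z => (inner ℝ (a z) v) • a z := by
  have := ex_clm D (ContinuousLinearMap.apply ℝ V v) fun z => (innerSL ℝ (a z)).smulRight (a z)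
  simpa [secondMoment] using this.symm

theorem norm_secondMoment_apply_le (D : PMF Z) [FinSupp D] (a : Z → V) {B : ℝ}
    (hB : ∀ z, ‖a z‖ ≤ B) (v : V) : ‖secondMoment D a v‖ ≤ B ^ 2 * ‖v‖ := by
  rw [secondMoment_apply]
  refine norm_ex_le_const D fun z => ?_
  rw [norm_smul]
  have h1 := norm_inner_le_norm (𝕜 := ℝ) (a z) v
  have h2 := hB z
  have h3 := norm_nonneg (a z)
  calc ‖inner ℝ (a z) v‖ * ‖a z‖ ≤ (‖a z‖ * ‖v‖) * ‖a z‖ := by gcongr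
    _ ≤ (B * ‖v‖) * B :=
        mul_le_mul (mul_le_mul_of_nonneg_right h2 (norm_nonneg v)) h2 h3
          (mul_nonneg (h3.trans h2) (norm_nonneg v))
    _ = B ^ 2 * ‖v‖ := by ring

theorem le_norm_secondMoment_apply (D : PMF Z) [FinSupp D] (a : Z → V) {μ : ℝ}
    (hμ : ∀ v, μ * ‖v‖ ^ 2 ≤ ex D fun z => inner ℝ (a z) v ^ 2) (v : V) :
    μ * ‖v‖ ≤ ‖secondMoment D a v‖ := by
  have h1 : (ex D fun z => inner ℝ (a z) v ^ 2) = inner ℝ v (secondMoment D a v) := by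
    rw [secondMoment_apply, ← ex_inner]
    refine ex_congr D fun z => ?_
    rw [inner_smul_right, real_inner_comm, sq]
  have h2 := (hμ v).trans_eq h1 |>.trans (real_inner_le_norm _ _)
  rcases (norm_nonneg v).eq_or_lt with h | h
  · rw [← h, mul_zero]
    exact norm_nonneg _
  · nlinarith

/-- The stochastic gradient `(⟨a, e⟩ - ξ) a` at the distance `e` from the minimizer, where `ξ` is
the residual at the minimizer. -/
def residualGrad (a : Z → V) (ξ : Z → ℝ) (e : V) (z : Z) : V := (inner ℝ (a z) e - ξ z) • a z

/-- The hypothesis `hξ` is the normal equation at the minimizer; it removes the noise from the mean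
gradient. -/
theorem ex_residualGrad (D : PMF Z) [FinSupp D] (a : Z → V) (ξ : Z → ℝ)
    (hξ : (ex D fun z => ξ z • a z) = 0) (e : V) :
    ex D (residualGrad a ξ e) = secondMoment D a e := by
  have : residualGrad a ξ e = fun z => (inner ℝ (a z) e) • a z - ξ z • a z := by
    funext z
    rw [residualGrad, sub_smul]
  rw [this, ex_sub, hξ, sub_zero, secondMoment_apply]

theorem ex_norm_residualGrad_sq_le (D : PMF Z) [FinSupp D] (a : Z → V) (ξ : Z → ℝ) {B σ : ℝ}
    (hB : ∀ z, ‖a z‖ ≤ B) (hσ : ∀ z, |ξ z| ≤ σ) (e : V) :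
    (ex D fun z => ‖residualGrad a ξ e z‖ ^ 2) ≤
      B ^ 2 * (2 * (ex D fun z => inner ℝ (a z) e ^ 2) + 2 * σ ^ 2) := by
  have h : ∀ z, ‖residualGrad a ξ e z‖ ^ 2 ≤
      B ^ 2 * (2 * inner ℝ (a z) e ^ 2 + 2 * σ ^ 2) := fun z => by
    rw [residualGrad, norm_smul, mul_pow, mul_comm, Real.norm_eq_abs, sq_abs]
    have h1 : ‖a z‖ ^ 2 ≤ B ^ 2 := pow_le_pow_left₀ (norm_nonneg _) (hB z) 2
    have h2 : ξ z ^ 2 ≤ σ ^ 2 := sq_le_sq' (neg_le_of_abs_le (hσ z)) (le_of_abs_le (hσ z))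
    have h3 : (inner ℝ (a z) e - ξ z) ^ 2 ≤ 2 * inner ℝ (a z) e ^ 2 + 2 * σ ^ 2 := by
      nlinarith [sq_nonneg (inner ℝ (a z) e + ξ z)]
    exact mul_le_mul h1 h3 (sq_nonneg _) (sq_nonneg _)
  refine (ex_mono D h).trans_eq ?_
  rw [ex_mul, ex_add, ex_mul, ex_const]

/-- With Q = E⟨a,e⟩², expanding the square gives ‖e‖² - 2ηQ + η²E‖g‖², and the second moment of g is
at most B²(2Q + 2σ²). The condition ηB² ≤ 1/4 lets half of ηQ pay for the quadratic term, leaving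
more than the ηQ ≥ ημ‖e‖² needed for contraction. -/
theorem ex_norm_sub_residualGrad_sq_le (D : PMF Z) [FinSupp D] (a : Z → V) (ξ : Z → ℝ)
    {B σ μ η : ℝ} (hB : ∀ z, ‖a z‖ ≤ B) (hσ : ∀ z, |ξ z| ≤ σ)
    (hξ : (ex D fun z => ξ z • a z) = 0)
    (hμ : ∀ v, μ * ‖v‖ ^ 2 ≤ ex D fun z => inner ℝ (a z) v ^ 2) (hη : 0 < η)
    (hηB : η * B ^ 2 ≤ 1 / 4) (e : V) :
    (ex D fun z => ‖e - η • residualGrad a ξ e z‖ ^ 2) ≤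
      (1 - η * μ) * ‖e‖ ^ 2 + η * σ ^ 2 / 2 := by
  set Q := ex D fun z => inner ℝ (a z) e ^ 2
  have hQ0 : 0 ≤ Q := ex_nonneg D fun z => sq_nonneg _
  have h1 : ∀ z, ‖e - η • residualGrad a ξ e z‖ ^ 2 =
      ‖e‖ ^ 2 - (2 * η) * inner ℝ e (residualGrad a ξ e z) +
        η ^ 2 * ‖residualGrad a ξ e z‖ ^ 2 := fun z => by
    rw [norm_sub_sq_real, inner_smul_right, norm_smul, mul_pow, Real.norm_eq_abs, sq_abs]
    ring
  have h2 : inner ℝ e (secondMoment D a e) = Q := by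
    rw [secondMoment_apply, ← ex_inner]
    refine ex_congr D fun z => ?_
    rw [inner_smul_right, real_inner_comm, sq]
  simp only [h1]
  rw [ex_add, ex_sub, ex_const, ex_mul, ex_mul, ex_inner, ex_residualGrad D a ξ hξ, h2]
  have h3 := ex_norm_residualGrad_sq_le D a ξ hB hσ e
  have h4 : η ^ 2 * (ex D fun z => ‖residualGrad a ξ e z‖ ^ 2) ≤
      η * (1 / 4 * (2 * Q + 2 * σ ^ 2)) := by
    calc _ ≤ η ^ 2 * (B ^ 2 * (2 * Q + 2 * σ ^ 2)) := by gcongr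
      _ = η * ((η * B ^ 2) * (2 * Q + 2 * σ ^ 2)) := by ring
      _ ≤ _ := by gcongr
  have h5 := mul_le_mul_of_nonneg_left (hμ e) hη.le
  change η * (μ * ‖e‖ ^ 2) ≤ η * Q at h5
  nlinarith [mul_nonneg hη.le hQ0]

end LeastSquares

/-! ### Averaged stochastic gradient descent -/

/-- A step of averaged stochastic gradient descent, seen from the minimizer `w`. -/
def lsStep {Z : Type*} {m : ℕ} (a : Z → E m) (ξ : Z → ℝ) (w : E m) (η : ℝ) (c : ℕ)
    (x : SGDState m) (z : Z) : SGDState m :=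
  ⟨x.iterate - η • residualGrad a ξ (x.iterate - w) z,
    x.total + (x.iterate - η • residualGrad a ξ (x.iterate - w) z), x.samples + c⟩

section AveragedSGD

variable {Z : Type*} {m : ℕ} {D : PMF Z} [FinSupp D] {a : Z → E m} {ξ : Z → ℝ} {w : E m}
  {B σ μ η R : ℝ} {c : ℕ} {p : ℕ → PMF (SGDState m)} [∀ k, FinSupp (p k)]

/-- With constant step size the iterates stay bounded in mean square but need not converge; σ²/(2μ)
is the fixed point of the one-step bound x ↦ (1 - ημ)x + ησ²/2. -/
theorem ex_iterate_sub_sq_le (hB : ∀ z, ‖a z‖ ≤ B) (hσ : ∀ z, |ξ z| ≤ σ)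
    (hξ : (ex D fun z => ξ z • a z) = 0)
    (hμ : ∀ v, μ * ‖v‖ ^ 2 ≤ ex D fun z => inner ℝ (a z) v ^ 2) (hμ0 : 0 < μ)
    (hμB : μ ≤ B ^ 2) (hη : 0 < η) (hηB : η * B ^ 2 ≤ 1 / 4) (hw : ‖w‖ ≤ R)
    (hp0 : p 0 = PMF.pure ⟨0, 0, 0⟩)
    (hp : ∀ k, p (k + 1) = (p k).bind fun x => D.bind fun z => PMF.pure (lsStep a ξ w η c x z))
    (k : ℕ) :
    (ex (p k) fun x => ‖x.iterate - w‖ ^ 2) ≤ R ^ 2 + σ ^ 2 / (2 * μ) := by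
  induction k with
  | zero =>
    rw [hp0, ex_pure]
    have : ‖w‖ ^ 2 ≤ R ^ 2 := pow_le_pow_left₀ (norm_nonneg _) hw 2
    have : 0 ≤ σ ^ 2 / (2 * μ) := by positivity
    simp only [zero_sub, norm_neg]
    linarith
  | succ k ih =>
    rw [hp, ex_bind]
    simp only [ex_bind, ex_pure, lsStep]
    have h1 : ∀ x : SGDState m,
        (ex D fun z => ‖x.iterate - η • residualGrad a ξ (x.iterate - w) z - w‖ ^ 2) ≤
          (1 - η * μ) * ‖x.iterate - w‖ ^ 2 + η * σ ^ 2 / 2 := fun x => by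
      have := ex_norm_sub_residualGrad_sq_le D a ξ hB hσ hξ hμ hη hηB (x.iterate - w)
      simp only [sub_right_comm _ w] at this
      exact this
    refine (ex_mono _ h1).trans ?_
    rw [ex_add, ex_mul, ex_const]
    have h2 : 0 ≤ 1 - η * μ := by nlinarith
    have h3 := mul_le_mul_of_nonneg_left ih h2
    have h4 : (1 - η * μ) * (R ^ 2 + σ ^ 2 / (2 * μ)) + η * σ ^ 2 / 2 =
        (R ^ 2 + σ ^ 2 / (2 * μ)) - η * μ * R ^ 2 := by
      field_simp
      ring
    have : 0 ≤ η * μ * R ^ 2 := by positivity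
    linarith

/-- The martingale part of the averaged recursion. -/
def sgdMartingale (D : PMF Z) (a : Z → E m) (w : E m) (η : ℝ) (k : ℕ) (x : SGDState m) : E m :=
  secondMoment D a (x.total - (k : ℝ) • w - x.iterate) + (1 / η) • x.iterate

/-- Since ω_0 = 0, total minus last iterate is ω_0 + ⋯ + ω_{k-1}, and ω_k/η is minus the sum of the
stochastic gradients. So `sgdMartingale` is the sum of the differences between mean and sampled
gradients. These are conditionally centered, so their second moments add up. -/
theorem ex_sgdMartingale_sq_le {G : ℝ} (hη : η ≠ 0)
    (hξ : (ex D fun z => ξ z • a z) = 0)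
    (hG : ∀ k, (ex (p k) fun x => ex D fun z => ‖residualGrad a ξ (x.iterate - w) z‖ ^ 2) ≤ G)
    (hp0 : p 0 = PMF.pure ⟨0, 0, 0⟩)
    (hp : ∀ k, p (k + 1) = (p k).bind fun x => D.bind fun z => PMF.pure (lsStep a ξ w η c x z))
    (k : ℕ) :
    (ex (p k) fun x => ‖sgdMartingale D a w η k x‖ ^ 2) ≤ k * G := by
  induction k with
  | zero => simp [hp0, ex_pure, sgdMartingale]
  | succ k ih =>
    rw [hp, ex_bind]
    simp only [ex_bind, ex_pure]
    have h1 : ∀ (x : SGDState m) z, sgdMartingale D a w η (k + 1) (lsStep a ξ w η c x z) =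
        sgdMartingale D a w η k x + (secondMoment D a (x.iterate - w) -
          residualGrad a ξ (x.iterate - w) z) := fun x z => by
      simp only [sgdMartingale, lsStep]
      generalize residualGrad a ξ (x.iterate - w) z = g
      have e1 : x.total + (x.iterate - η • g) - ((k + 1 : ℕ) : ℝ) • w - (x.iterate - η • g) =
          (x.total - (k : ℝ) • w - x.iterate) + (x.iterate - w) := by
        push_cast
        module
      rw [e1, map_add, smul_sub, smul_smul, one_div, inv_mul_cancel₀ hη, one_smul]
      abel
    have h2 : ∀ x : SGDState m,
        (ex D fun z => ‖sgdMartingale D a w η (k + 1) (lsStep a ξ w η c x z)‖ ^ 2) ≤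
          ‖sgdMartingale D a w η k x‖ ^ 2 +
            ex D fun z => ‖residualGrad a ξ (x.iterate - w) z‖ ^ 2 := fun x => by
      simp only [h1]
      set v := secondMoment D a (x.iterate - w)
      have hv : ex D (residualGrad a ξ (x.iterate - w)) = v := ex_residualGrad D a ξ hξ _
      rw [ex_norm_add_sq _ _ _ (by rw [ex_sub, ex_const, hv, sub_self])]
      have h3 := ex_norm_add_sq D (-v) (fun z => v - residualGrad a ξ (x.iterate - w) z)
        (by rw [ex_sub, ex_const, hv, sub_self])
      simp only [neg_add_eq_sub, sub_sub_cancel_left, norm_neg] at h3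
      rw [h3]
      linarith [sq_nonneg ‖v‖]
    refine (ex_mono _ h2).trans ?_
    rw [ex_add]
    push_cast
    linarith [hG k]

/-- The mean squared distance from the minimizer, after averaging, is `O(1/K)`. -/
theorem ex_average_sub_sq_le (hB : ∀ z, ‖a z‖ ≤ B) (hσ : ∀ z, |ξ z| ≤ σ)
    (hξ : (ex D fun z => ξ z • a z) = 0)
    (hμ : ∀ v, μ * ‖v‖ ^ 2 ≤ ex D fun z => inner ℝ (a z) v ^ 2) (hμ0 : 0 < μ)
    (hμB : μ ≤ B ^ 2) (hη : 0 < η) (hηB : η * B ^ 2 ≤ 1 / 4) (hw : ‖w‖ ≤ R)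
    (hp0 : p 0 = PMF.pure ⟨0, 0, 0⟩)
    (hp : ∀ k, p (k + 1) = (p k).bind fun x => D.bind fun z => PMF.pure (lsStep a ξ w η c x z))
    {K : ℕ} (hK : 1 ≤ K) :
    (ex (p K) fun x => ‖(1 / (K : ℝ)) • x.total - w‖ ^ 2) ≤
      (4 * B ^ 2 * (B ^ 2 * (R ^ 2 + σ ^ 2 / (2 * μ)) + σ ^ 2) +
        4 * (1 / η + B ^ 2) ^ 2 * ((R ^ 2 + σ ^ 2 / (2 * μ)) + R ^ 2)) / μ ^ 2 / K := by
  set Q := R ^ 2 + σ ^ 2 / (2 * μ)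
  have hK' : (1 : ℝ) ≤ K := by exact_mod_cast hK
  have hit := ex_iterate_sub_sq_le hB hσ hξ hμ hμ0 hμB hη hηB hw hp0 hp
  have hG : ∀ k, (ex (p k) fun x => ex D fun z => ‖residualGrad a ξ (x.iterate - w) z‖ ^ 2) ≤
      2 * B ^ 2 * (B ^ 2 * Q + σ ^ 2) := fun k => by
    have h1 : ∀ x : SGDState m, (ex D fun z => ‖residualGrad a ξ (x.iterate - w) z‖ ^ 2) ≤
        (2 * B ^ 4) * ‖x.iterate - w‖ ^ 2 + 2 * B ^ 2 * σ ^ 2 := fun x => by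
      refine (ex_norm_residualGrad_sq_le D a ξ hB hσ _).trans ?_
      have : (ex D fun z => inner ℝ (a z) (x.iterate - w) ^ 2) ≤
          B ^ 2 * ‖x.iterate - w‖ ^ 2 := by
        refine ex_le_const D fun z => ?_
        rw [← mul_pow, ← sq_abs]
        refine pow_le_pow_left₀ (abs_nonneg _) ((abs_real_inner_le_norm _ _).trans ?_) 2
        gcongr
        exact hB z
      nlinarith [mul_le_mul_of_nonneg_left this (sq_nonneg B)]
    refine (ex_mono _ h1).trans ?_
    rw [ex_add, ex_mul, ex_const]
    have := mul_le_mul_of_nonneg_left (hit k) (by positivity : 0 ≤ 2 * B ^ 4)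
    linarith
  have hM := ex_sgdMartingale_sq_le (c := c) hη.ne' hξ hG hp0 hp K
  have hR : ‖w‖ ^ 2 ≤ R ^ 2 := pow_le_pow_left₀ (norm_nonneg _) hw 2
  have key : ∀ x : SGDState m, ‖(1 / (K : ℝ)) • x.total - w‖ ^ 2 ≤
      (1 / K ^ 2 / μ ^ 2) * (2 * ‖sgdMartingale D a w η K x‖ ^ 2 +
        2 * (1 / η + B ^ 2) ^ 2 * (2 * ‖x.iterate - w‖ ^ 2 + 2 * R ^ 2)) := fun x => by
    set u := x.total - (K : ℝ) • w
    have e1 : (1 / (K : ℝ)) • x.total - w = (1 / (K : ℝ)) • u := by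
      simp only [u]
      rw [smul_sub, smul_smul, one_div, inv_mul_cancel₀ (by positivity), one_smul]
    -- The sum of the errors, seen through the covariance operator, is the martingale up to a term
    -- in the last iterate alone. Inverting the operator costs 1/μ.
    have e2 : secondMoment D a u = sgdMartingale D a w η K x +
        (secondMoment D a x.iterate - (1 / η) • x.iterate) := by
      simp only [sgdMartingale, u, map_sub]
      abel
    have e3 : ‖secondMoment D a x.iterate - (1 / η) • x.iterate‖ ≤
        (1 / η + B ^ 2) * ‖x.iterate‖ := by
      refine (norm_sub_le _ _).trans ?_
      rw [norm_smul, Real.norm_of_nonneg (by positivity)]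
      linarith [norm_secondMoment_apply_le D a hB x.iterate]
    have e4 : μ * ‖u‖ ≤ ‖sgdMartingale D a w η K x‖ + (1 / η + B ^ 2) * ‖x.iterate‖ :=
      (le_norm_secondMoment_apply D a hμ u).trans
        (e2 ▸ (norm_add_le _ _).trans (by gcongr))
    have e5 : ‖x.iterate‖ ^ 2 ≤ 2 * ‖x.iterate - w‖ ^ 2 + 2 * R ^ 2 := by
      have h1 : ‖x.iterate‖ ≤ ‖x.iterate - w‖ + ‖w‖ := by
        simpa using norm_add_le (x.iterate - w) w
      have h2 := pow_le_pow_left₀ (norm_nonneg _) h1 2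
      nlinarith [sq_nonneg (‖x.iterate - w‖ - ‖w‖)]
    have e6 : (μ * ‖u‖) ^ 2 ≤ 2 * ‖sgdMartingale D a w η K x‖ ^ 2 +
        2 * (1 / η + B ^ 2) ^ 2 * (2 * ‖x.iterate - w‖ ^ 2 + 2 * R ^ 2) := by
      have h2 := pow_le_pow_left₀ (by positivity) e4 2
      have h3 := mul_le_mul_of_nonneg_left e5 (by positivity : 0 ≤ 2 * (1 / η + B ^ 2) ^ 2)
      nlinarith [sq_nonneg (‖sgdMartingale D a w η K x‖ - (1 / η + B ^ 2) * ‖x.iterate‖)]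
    rw [e1, norm_smul, mul_pow, Real.norm_of_nonneg (by positivity)]
    calc (1 / (K : ℝ)) ^ 2 * ‖u‖ ^ 2 = (1 / K ^ 2 / μ ^ 2) * (μ * ‖u‖) ^ 2 := by
          field_simp
      _ ≤ _ := by gcongr
  refine (ex_mono _ key).trans ?_
  rw [ex_mul, ex_add, ex_mul, ex_mul, ex_add, ex_mul, ex_const]
  have hQ0 : 0 ≤ Q := by positivity
  calc _ ≤ (1 / (K : ℝ) ^ 2 / μ ^ 2) * (2 * (K * (2 * B ^ 2 * (B ^ 2 * Q + σ ^ 2))) +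
        2 * (1 / η + B ^ 2) ^ 2 * (2 * Q + 2 * R ^ 2)) := by
        gcongr
        exact hit K
    _ ≤ (1 / (K : ℝ) ^ 2 / μ ^ 2) * (2 * (K * (2 * B ^ 2 * (B ^ 2 * Q + σ ^ 2))) +
        K * (2 * (1 / η + B ^ 2) ^ 2 * (2 * Q + 2 * R ^ 2))) := by
        -- The boundary term is O(1/K²) after averaging; K ≥ 1 degrades it to O(1/K) to merge it
        -- with the martingale term.
        have : 2 * (1 / η + B ^ 2) ^ 2 * (2 * Q + 2 * R ^ 2) ≤
            K * (2 * (1 / η + B ^ 2) ^ 2 * (2 * Q + 2 * R ^ 2)) :=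
          le_mul_of_one_le_left (by positivity) hK'
        exact mul_le_mul_of_nonneg_left (by linarith) (by positivity)
    _ = _ := by
        field_simp
        ring

end AveragedSGD

/-! ### Discounted moments and tails -/

section Moments

/-- `∑_t γ^t (t+1)^k`. -/
def momentSum (γ : ℝ) (k : ℕ) : ℝ := ∑' t : ℕ, γ ^ t * ((t : ℝ) + 1) ^ k

theorem summable_momentSum {γ : ℝ} (h0 : 0 < γ) (h1 : γ < 1) (k : ℕ) :
    Summable fun t : ℕ => γ ^ t * ((t : ℝ) + 1) ^ k := by
  have h := summable_pow_mul_geometric_of_norm_lt_one (R := ℝ) k (r := γ)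
    (by rwa [Real.norm_of_nonneg h0.le])
  rw [← summable_nat_add_iff 1] at h
  refine (h.mul_left γ⁻¹).congr fun t => ?_
  push_cast
  rw [pow_succ]
  field_simp

theorem momentSum_pos {γ : ℝ} (h0 : 0 < γ) (h1 : γ < 1) (k : ℕ) : 0 < momentSum γ k :=
  (summable_momentSum h0 h1 k).tsum_pos (fun t => by positivity) 0 (by positivity)

theorem sum_range_le_momentSum {γ : ℝ} (h0 : 0 < γ) (h1 : γ < 1) (k H : ℕ) :
    ∑ t ∈ Finset.range H, γ ^ t * ((t : ℝ) + 1) ^ k ≤ momentSum γ k :=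
  (summable_momentSum h0 h1 k).sum_le_tsum _ fun t _ => by positivity

/-- The tail of a series dominated by `γ^t (t+1)` decays like `√γ ^ H`. -/
theorem norm_tsum_sub_sum_range_le {V : Type*} [NormedAddCommGroup V] [CompleteSpace V]
    {γ : ℝ} (h0 : 0 < γ) (h1 : γ < 1) {f : ℕ → V} {c : ℝ}
    (hf : ∀ t, ‖f t‖ ≤ c * (γ ^ t * ((t : ℝ) + 1))) (H : ℕ) :
    ‖∑' t, f t - ∑ t ∈ Finset.range H, f t‖ ≤ c * (√γ ^ H * momentSum √γ 1) := by
  have hs0 : 0 < √γ := Real.sqrt_pos.mpr h0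
  have hs1 : √γ < 1 := by rwa [Real.sqrt_lt' one_pos, one_pow]
  have hc : 0 ≤ c := by simpa using (norm_nonneg _).trans (hf 0)
  have hsum : Summable f := by
    refine Summable.of_norm_bounded ((summable_momentSum h0 h1 1).mul_left c) fun t => ?_
    simpa using hf t
  have hm := summable_momentSum hs0 hs1 1
  have hm' := (summable_nat_add_iff H).mpr hm
  rw [← hsum.sum_add_tsum_nat_add H, add_sub_cancel_left]
  have hb : ∀ t, ‖f (t + H)‖ ≤
      (c * √γ ^ H) * (√γ ^ (t + H) * (((t + H : ℕ) : ℝ) + 1) ^ 1) := fun t => by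
    refine (hf (t + H)).trans ?_
    -- Half of the geometric decay is given to the tail factor; the other half keeps the series with
    -- the linear weight summable, uniformly in `H`.
    have : γ ^ (t + H) ≤ √γ ^ H * √γ ^ (t + H) := by
      rw [← pow_add]
      calc γ ^ (t + H) = √γ ^ (2 * (t + H)) := by rw [pow_mul, Real.sq_sqrt h0.le]
        _ ≤ _ := pow_le_pow_of_le_one hs0.le hs1.le (by omega)
    rw [pow_one, mul_assoc, ← mul_assoc (√γ ^ H)]
    gcongr
  refine (tsum_of_norm_bounded (hm'.mul_left (c * √γ ^ H)).hasSum hb).trans ?_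
  rw [tsum_mul_left, ← mul_assoc]
  gcongr
  rw [momentSum, ← hm.sum_add_tsum_nat_add H]
  have : 0 ≤ ∑ i ∈ Finset.range H, √γ ^ i * ((i : ℝ) + 1) ^ 1 :=
    Finset.sum_nonneg fun i _ => by positivity
  linarith

end Moments

/-! ### Differentiating expectations through the score -/

section Score

variable {X V : Type*} [Fintype X] [NormedAddCommGroup V] [InnerProductSpace ℝ V] {d : ℕ}

theorem abs_sub_le_of_hasFDerivAt {f : E d → ℝ} {g : E d → E d} {C : ℝ}
    (hf : ∀ x, HasFDerivAt f (innerSL ℝ (g x)) x) (hg : ∀ x, ‖g x‖ ≤ C) (x y : E d) :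
    |f x - f y| ≤ C * ‖x - y‖ :=
  convex_univ.norm_image_sub_le_of_norm_hasFDerivWithin_le
    (fun x _ => (hf x).hasFDerivWithinAt) (fun x _ => by rw [innerSL_apply_norm]; exact hg x)
    (Set.mem_univ y) (Set.mem_univ x)

/-- `sc` is the score (the gradient of the log-likelihood) of the family `p` of laws. -/
def IsScore (p : E d → PMF X) (sc : E d → X → E d) : Prop :=
  ∀ θ x, HasFDerivAt (fun θ' => (p θ' x).toReal) (innerSL ℝ ((p θ x).toReal • sc θ x)) θ

variable {p : E d → PMF X} {sc : E d → X → E d}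

theorem IsScore.hasFDerivAt_ex (h : IsScore p sc) (f : X → ℝ) (θ : E d) :
    HasFDerivAt (fun θ' => ex (p θ') f) (innerSL ℝ (ex (p θ) fun x => f x • sc θ x)) θ := by
  simp only [ex_eq_sum, map_sum, smul_eq_mul]
  refine HasFDerivAt.fun_sum fun x _ => ?_
  refine ((h θ x).mul_const (f x)).congr_fderiv ?_
  simp only [map_smul]
  rw [smul_comm]

theorem IsScore.abs_sub_le (h : IsScore p sc) {b : ℝ} (hb : ∀ θ x, ‖sc θ x‖ ≤ b)
    {f : X → ℝ} {c : ℝ} (hf : ∀ x, |f x| ≤ c) (θ θ' : E d) :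
    |ex (p θ) f - ex (p θ') f| ≤ c * b * ‖θ - θ'‖ := by
  refine abs_sub_le_of_hasFDerivAt (fun θ => h.hasFDerivAt_ex f θ) (fun θ => ?_) θ θ'
  refine norm_ex_le_const _ fun x => ?_
  rw [norm_smul]
  exact mul_le_mul (hf x) (hb θ x) (norm_nonneg _) ((abs_nonneg _).trans (hf x))

/-- The vector-valued case follows from the scalar one by pairing `f` with the difference of
expectations itself and cancelling one factor of its norm. -/
theorem IsScore.norm_sub_le (h : IsScore p sc) {b : ℝ} (hb : ∀ θ x, ‖sc θ x‖ ≤ b)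
    {f : X → V} {c : ℝ} (hf : ∀ x, ‖f x‖ ≤ c) (θ θ' : E d) :
    ‖ex (p θ) f - ex (p θ') f‖ ≤ c * b * ‖θ - θ'‖ := by
  set v := ex (p θ) f - ex (p θ') f with hv
  obtain ⟨x₀, _⟩ := (p θ).support_nonempty
  have hc : 0 ≤ c := (norm_nonneg _).trans (hf x₀)
  have hb0 : 0 ≤ b := (norm_nonneg _).trans (hb θ x₀)
  have h1 : ∀ x, |inner ℝ v (f x)| ≤ ‖v‖ * c := fun x =>
    (abs_real_inner_le_norm _ _).trans (mul_le_mul_of_nonneg_left (hf x) (norm_nonneg _))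
  have h2 := h.abs_sub_le hb h1 θ θ'
  rw [ex_inner, ex_inner, ← inner_sub_right, ← hv, real_inner_self_eq_norm_sq] at h2
  have h3 := (le_abs_self _).trans h2
  rcases (norm_nonneg v).eq_or_lt with h0 | h0
  · rw [← h0]
    positivity
  · nlinarith

/-- First the law varies with the score frozen, giving cb², then the score varies under a fixed law,
giving cl. -/
theorem IsScore.norm_grad_sub_le (h : IsScore p sc) {b l : ℝ} (hb : ∀ θ x, ‖sc θ x‖ ≤ b)
    (hl : ∀ θ θ' x, ‖sc θ x - sc θ' x‖ ≤ l * ‖θ - θ'‖) {f : X → ℝ} {c : ℝ}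
    (hf : ∀ x, |f x| ≤ c) (θ θ' : E d) :
    ‖(ex (p θ) fun x => f x • sc θ x) - ex (p θ') fun x => f x • sc θ' x‖ ≤
      c * (b ^ 2 + l) * ‖θ - θ'‖ := by
  obtain ⟨x₀, _⟩ := (p θ).support_nonempty
  have hc : 0 ≤ c := (abs_nonneg _).trans (hf x₀)
  have h1 : ‖(ex (p θ) fun x => f x • sc θ x) - ex (p θ') fun x => f x • sc θ x‖ ≤
      (c * b) * b * ‖θ - θ'‖ := by
    refine h.norm_sub_le hb (fun x => ?_) θ θ'
    rw [norm_smul]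
    exact mul_le_mul (hf x) (hb θ x) (norm_nonneg _) hc
  have h2 : ‖(ex (p θ') fun x => f x • sc θ x) - ex (p θ') fun x => f x • sc θ' x‖ ≤
      c * (l * ‖θ - θ'‖) := by
    rw [← ex_sub]
    refine norm_ex_le_const _ fun x => ?_
    rw [← smul_sub, norm_smul]
    exact mul_le_mul (hf x) (hl θ θ' x) (norm_nonneg _) hc
  have h3 := norm_sub_le_norm_sub_add_norm_sub (ex (p θ) fun x => f x • sc θ x)
    (ex (p θ') fun x => f x • sc θ x) (ex (p θ') fun x => f x • sc θ' x)
  nlinarith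

end Score

/-! ### Softmax policies and their score -/

section Softmax

variable {A : Type*} [Fintype A] [Nonempty A]

theorem sum_exp_pos (v : A → ℝ) : 0 < ∑ a, Real.exp (v a) :=
  Finset.sum_pos (fun _ _ => Real.exp_pos _) Finset.univ_nonempty

theorem softmaxProb_pos (v : A → ℝ) (a : A) : 0 < softmaxProb v a :=
  div_pos (Real.exp_pos _) (sum_exp_pos v)

theorem softmax_toReal (v : A → ℝ) (a : A) : (softmax v a).toReal = softmaxProb v a := by
  simp [softmax, (softmaxProb_pos v a).le]

theorem log_softmaxProb (v : A → ℝ) (a : A) :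
    Real.log (softmaxProb v a) = v a - Real.log (∑ b, Real.exp (v b)) := by
  rw [softmaxProb, Real.log_div (Real.exp_ne_zero _) (sum_exp_pos v).ne', Real.log_exp]

end Softmax

namespace Problem

variable {S A : Type*} [Fintype S] [Fintype A] {d m : ℕ} {M : Problem S A d m} {lψ Lψ : ℝ}

section Policy

theorem PolicyRegular.hasFDerivAt (h : M.PolicyRegular lψ Lψ) (s : S) (a : A) (θ : E d) :
    HasFDerivAt (M.ψ s a) (innerSL ℝ (gradient (M.ψ s a) θ)) θ :=
  (((h.contDiff s a).differentiable (by norm_num)) θ).hasGradientAt.hasFDerivAt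

theorem PolicyRegular.norm_gradient_sub_le (h : M.PolicyRegular lψ Lψ) (s : S) (a : A)
    (θ θ' : E d) : ‖gradient (M.ψ s a) θ - gradient (M.ψ s a) θ'‖ ≤ Lψ * ‖θ - θ'‖ := by
  have hd : Differentiable ℝ (gradient (M.ψ s a)) := by
    have h1 : ContDiff ℝ 1 (fderiv ℝ (M.ψ s a)) :=
      (h.contDiff s a).fderiv_right (by norm_num)
    exact (InnerProductSpace.toDual ℝ (E d)).symm.differentiable.comp
      (h1.differentiable (by norm_num))
  exact convex_univ.norm_image_sub_le_of_norm_fderiv_le (fun x _ => hd x)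
    (fun x _ => h.hess_le s a x) (Set.mem_univ θ') (Set.mem_univ θ)

variable [Nonempty A]

theorem PolicyRegular.hasFDerivAt_log (h : M.PolicyRegular lψ Lψ) (s : S) (a : A) (θ : E d) :
    HasFDerivAt (fun θ' => Real.log (softmaxProb (fun a' => M.ψ s a' θ') a))
      (innerSL ℝ (gradient (M.ψ s a) θ - ex (M.policy θ s) fun b => gradient (M.ψ s b) θ)) θ := by
  simp only [log_softmaxProb, map_sub]
  refine (h.hasFDerivAt s a θ).sub ?_
  have h1 : HasFDerivAt (fun θ' => ∑ b, Real.exp (M.ψ s b θ'))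
      (∑ b, Real.exp (M.ψ s b θ) • innerSL ℝ (gradient (M.ψ s b) θ)) θ :=
    HasFDerivAt.fun_sum fun b _ => (h.hasFDerivAt s b θ).exp
  refine (h1.log (sum_exp_pos fun b => M.ψ s b θ).ne').congr_fderiv ?_
  rw [ex_eq_sum, map_sum, Finset.smul_sum]
  refine Finset.sum_congr rfl fun b _ => ?_
  rw [map_smul, policy, softmax_toReal, softmaxProb, smul_smul, div_eq_inv_mul]

theorem PolicyRegular.score_eq (h : M.PolicyRegular lψ Lψ) (s : S) (a : A) (θ : E d) :
    M.score θ s a = gradient (M.ψ s a) θ - ex (M.policy θ s) fun b => gradient (M.ψ s b) θ :=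
  HasGradientAt.gradient (h.hasFDerivAt_log s a θ)

theorem PolicyRegular.isScore_policy (h : M.PolicyRegular lψ Lψ) (s : S) :
    IsScore (fun θ => M.policy θ s) fun θ a => M.score θ s a := by
  intro θ a
  have h1 := (h.hasFDerivAt_log s a θ).exp
  rw [← h.score_eq] at h1
  simp only [Real.exp_log (softmaxProb_pos _ _)] at h1
  simp only [policy, softmax_toReal, map_smul]
  exact h1

theorem PolicyRegular.norm_score_le (h : M.PolicyRegular lψ Lψ) (θ : E d) (s : S) (a : A) :
    ‖M.score θ s a‖ ≤ 2 * lψ := by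
  rw [h.score_eq]
  refine (norm_sub_le _ _).trans ?_
  have := norm_ex_le_const (M.policy θ s) fun b => h.grad_le s b θ
  linarith [h.grad_le s a θ]

/-- The score is ∇ψ minus its policy average. The two gradients contribute Lψ each; the change of
the averaging law contributes 2lψ², the score bound 2lψ times lψ. -/
theorem PolicyRegular.norm_score_sub_le (h : M.PolicyRegular lψ Lψ) (s : S) (a : A)
    (θ θ' : E d) :
    ‖M.score θ s a - M.score θ' s a‖ ≤ (2 * Lψ + 2 * lψ ^ 2) * ‖θ - θ'‖ := by
  rw [h.score_eq, h.score_eq]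
  have h1 := h.norm_gradient_sub_le s a θ θ'
  have h2 : ‖(ex (M.policy θ s) fun b => gradient (M.ψ s b) θ) -
      ex (M.policy θ s) fun b => gradient (M.ψ s b) θ'‖ ≤ Lψ * ‖θ - θ'‖ := by
    rw [← ex_sub]
    exact norm_ex_le_const _ fun b => h.norm_gradient_sub_le s b θ θ'
  have h3 := (h.isScore_policy s).norm_sub_le (fun θ a => h.norm_score_le θ s a)
    (fun b => h.grad_le s b θ') θ θ'
  set g := gradient (M.ψ s a) θ
  set g' := gradient (M.ψ s a) θ'
  set e := ex (M.policy θ s) fun b => gradient (M.ψ s b) θ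
  set e' := ex (M.policy θ s) fun b => gradient (M.ψ s b) θ'
  set e'' := ex (M.policy θ' s) fun b => gradient (M.ψ s b) θ'
  have h4 : g - e - (g' - e'') = (g - g') - (e - e') - (e' - e'') := by abel
  rw [h4]
  have h5 := norm_sub_le ((g - g') - (e - e')) (e' - e'')
  have h6 := norm_sub_le (g - g') (e - e')
  linarith

end Policy

end Problem

namespace Problem

variable {S A : Type*} [Fintype S] [Fintype A] {d m : ℕ} {M : Problem S A d m} {lψ Lψ : ℝ}

/-! ### Laws and scores of trajectories -/

section Trajectories

theorem ex_trajLaw_succ {V : Type*} [NormedAddCommGroup V] [NormedSpace ℝ V]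
    (π : S → PMF A) (n : ℕ) (f : (Fin (n + 1) → S × A) → V) :
    ex (M.trajLaw π (n + 1)) f = ex (M.trajLaw π n) fun τ => ex (M.nextState τ) fun s =>
      ex (π s) fun a => f (Fin.snoc τ (s, a)) := by
  rw [trajLaw]
  simp only [ex_bind, ex_pure]

theorem ex_trajLaw_init {V : Type*} [NormedAddCommGroup V] [NormedSpace ℝ V]
    (π : S → PMF A) (n : ℕ) (f : (Fin n → S × A) → V) :
    (ex (M.trajLaw π (n + 1)) fun τ => f (Fin.init τ)) = ex (M.trajLaw π n) f := by
  simp only [ex_trajLaw_succ, Fin.init_snoc, ex_const]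

theorem toReal_eq_ex {X : Type*} [DecidableEq X] (p : PMF X) (x : X) :
    (p x).toReal = ex p fun y => if y = x then (1 : ℝ) else 0 := by
  rw [ex, tsum_eq_single x fun y hy => by simp [hy]]
  simp

/-- The Markov factorization. The transition factor does not depend on the policy, so
differentiating in θ only adds the score of the last action; `PolicyRegular.isScore_traj` rests on
this. -/
theorem trajLaw_succ_apply (π : S → PMF A) (n : ℕ) (τ : Fin (n + 1) → S × A) :
    (M.trajLaw π (n + 1) τ).toReal = (M.trajLaw π n (Fin.init τ)).toReal *
      ((M.nextState (Fin.init τ) (τ (Fin.last n)).1).toReal *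
        (π (τ (Fin.last n)).1 (τ (Fin.last n)).2).toReal) := by
  classical
  rw [toReal_eq_ex, ex_trajLaw_succ, ex_eq_sum, Finset.sum_eq_single (Fin.init τ)]
  · congr 1
    rw [ex_eq_sum, Finset.sum_eq_single (τ (Fin.last n)).1]
    · congr 1
      rw [ex_eq_sum, Finset.sum_eq_single (τ (Fin.last n)).2]
      · simp
      · intro a _ ha
        rw [if_neg, smul_zero]
        intro e
        have e' := congrArg (fun σ => (σ (Fin.last n)).2) e
        simp only [Fin.snoc_last] at e'
        exact ha e'
      · simp
    · intro s _ hs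
      simp only [ex_eq_sum]
      rw [Finset.sum_eq_zero, smul_zero]
      intro a _
      rw [if_neg, smul_zero]
      intro e
      have e' := congrArg (fun σ => (σ (Fin.last n)).1) e
      simp only [Fin.snoc_last] at e'
      exact hs e'
    · simp
  · intro σ _ hσ
    simp only [ex_eq_sum]
    rw [Finset.sum_eq_zero, smul_zero]
    intro s _
    rw [Finset.sum_eq_zero, smul_zero]
    intro a _
    rw [if_neg, smul_zero]
    rintro rfl
    simp at hσ
  · simp

/-- The score of a trajectory. -/
def trajScore (M : Problem S A d m) {n : ℕ} (θ : E d) (τ : Fin n → S × A) : E d :=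
  ∑ i, M.score θ (τ i).1 (τ i).2

theorem trajScore_succ {n : ℕ} (θ : E d) (τ : Fin (n + 1) → S × A) :
    M.trajScore θ τ = M.trajScore θ (Fin.init τ) +
      M.score θ (τ (Fin.last n)).1 (τ (Fin.last n)).2 := by
  rw [trajScore, Fin.sum_univ_castSucc]
  rfl

variable [Nonempty A]

theorem PolicyRegular.isScore_traj (h : M.PolicyRegular lψ Lψ) (n : ℕ) :
    IsScore (fun θ => M.trajLaw (M.policy θ) n) fun θ τ => M.trajScore θ τ := by
  induction n with
  | zero =>
    intro θ τ
    simp only [trajLaw, trajScore, Finset.univ_eq_empty, Finset.sum_empty, smul_zero, map_zero]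
    exact hasFDerivAt_const _ _
  | succ n ih =>
    intro θ τ
    simp only [trajLaw_succ_apply]
    refine ((ih θ (Fin.init τ)).mul
      ((h.isScore_policy (τ (Fin.last n)).1 θ (τ (Fin.last n)).2).const_mul _)).congr_fderiv ?_
    rw [trajScore_succ]
    simp only [map_smul, map_add, smul_add, smul_smul]
    module

theorem PolicyRegular.norm_trajScore_le (h : M.PolicyRegular lψ Lψ) {n : ℕ} (θ : E d)
    (τ : Fin n → S × A) : ‖M.trajScore θ τ‖ ≤ 2 * lψ * n := by
  refine (norm_sum_le _ _).trans ((Finset.sum_le_sum fun i _ => h.norm_score_le θ _ _).trans ?_)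
  simp [mul_comm]

theorem PolicyRegular.norm_trajScore_sub_le (h : M.PolicyRegular lψ Lψ) {n : ℕ} (θ θ' : E d)
    (τ : Fin n → S × A) :
    ‖M.trajScore θ τ - M.trajScore θ' τ‖ ≤ (2 * Lψ + 2 * lψ ^ 2) * n * ‖θ - θ'‖ := by
  rw [trajScore, trajScore, ← Finset.sum_sub_distrib]
  refine (norm_sum_le _ _).trans
    ((Finset.sum_le_sum fun i _ => h.norm_score_sub_le _ _ θ θ').trans ?_)
  simp only [Finset.sum_const, Finset.card_univ, Fintype.card_fin, nsmul_eq_mul]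
  exact le_of_eq (by ring)

end Trajectories

/-! ### Occupancy measures and their derivatives -/

section Occupancy

theorem ex_pairLaw {V : Type*} [NormedAddCommGroup V] [NormedSpace ℝ V]
    (π : S → PMF A) (t : ℕ) (u : S × A → V) :
    ex (M.pairLaw π t) u = ex (M.trajLaw π (t + 1)) fun τ => u (τ (Fin.last t)) :=
  ex_map _ _ _

/-- The expected truncated discounted sum of `u` along a trajectory. -/
theorem ex_trajLaw_sum (π : S → PMF A) (H : ℕ) (u : S × A → ℝ) :
    (ex (M.trajLaw π H) fun τ => ∑ h : Fin H, M.γ ^ (h : ℕ) * u (τ h)) =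
      ∑ t ∈ Finset.range H, M.γ ^ t * ex (M.pairLaw π t) u := by
  induction H with
  | zero => simp [trajLaw, ex_pure]
  | succ H ih =>
    rw [Finset.sum_range_succ, ← ih, ex_pairLaw, ← ex_mul,
      ← ex_trajLaw_init (M := M) π H fun τ => ∑ h : Fin H, M.γ ^ (h : ℕ) * u (τ h), ← ex_add]
    refine ex_congr _ fun τ => ?_
    rw [Fin.sum_univ_castSucc]
    rfl

theorem sum_mul_occTrunc (π : S → PMF A) (H : ℕ) (u : S × A → ℝ) :
    ∑ p, u p * M.occTrunc H π p = ∑ t ∈ Finset.range H, M.γ ^ t * ex (M.pairLaw π t) u := by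
  simp only [occTrunc, ex_eq_sum, Finset.mul_sum]
  rw [Finset.sum_comm]
  refine Finset.sum_congr rfl fun t _ => Finset.sum_congr rfl fun p _ => ?_
  rw [smul_eq_mul]
  ring

theorem abs_ex_le_norm (p : PMF (S × A)) (u : S × A → ℝ) : |ex p u| ≤ ‖u‖ :=
  norm_ex_le_const p fun x => norm_le_pi_norm u x

theorem norm_term_le (hγ0 : 0 < M.γ) (π : S → PMF A) (u : S × A → ℝ) (t : ℕ) :
    ‖M.γ ^ t * ex (M.pairLaw π t) u‖ ≤ ‖u‖ * (M.γ ^ t * ((t : ℝ) + 1)) := by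
  rw [norm_mul, norm_pow, Real.norm_of_nonneg hγ0.le, Real.norm_eq_abs]
  have h1 := abs_ex_le_norm (M.pairLaw π t) u
  have h2 : ‖u‖ ≤ ‖u‖ * ((t : ℝ) + 1) :=
    le_mul_of_one_le_right (norm_nonneg _) (by linarith [t.cast_nonneg (α := ℝ)])
  calc _ ≤ M.γ ^ t * (‖u‖ * ((t : ℝ) + 1)) := by gcongr; exact h1.trans h2
    _ = _ := by ring

theorem summable_term (hγ0 : 0 < M.γ) (hγ1 : M.γ < 1) (π : S → PMF A) (u : S × A → ℝ) :
    Summable fun t => M.γ ^ t * ex (M.pairLaw π t) u :=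
  Summable.of_norm_bounded ((summable_momentSum hγ0 hγ1 1).mul_left ‖u‖) fun t => by
    simpa using norm_term_le hγ0 π u t

theorem summable_occ (hγ0 : 0 < M.γ) (hγ1 : M.γ < 1) (π : S → PMF A) (p : S × A) :
    Summable fun t => M.γ ^ t * (M.pairLaw π t p).toReal := by
  classical
  simp only [toReal_eq_ex]
  exact summable_term hγ0 hγ1 π _

theorem sum_mul_occ (hγ0 : 0 < M.γ) (hγ1 : M.γ < 1) (π : S → PMF A) (u : S × A → ℝ) :
    ∑ p, u p * M.occ π p = ∑' t, M.γ ^ t * ex (M.pairLaw π t) u := by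
  simp only [occ, ← tsum_mul_left]
  rw [← Summable.tsum_finsetSum fun p _ => (summable_occ hγ0 hγ1 π p).mul_left _]
  refine tsum_congr fun t => ?_
  rw [ex_eq_sum, Finset.mul_sum]
  refine Finset.sum_congr rfl fun p _ => ?_
  rw [smul_eq_mul]
  ring

/-- Duality of ℓ¹ and sup norms: it reduces ℓ¹ bounds on occupancy measures to bounds for pairings
with a reward of sup norm at most one. -/
theorem exists_sign (x : S × A → ℝ) :
    ∃ u : S × A → ℝ, ‖u‖ ≤ 1 ∧ ∑ p, |x p| = ∑ p, u p * x p := by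
  refine ⟨fun p => SignType.sign (x p), ?_, ?_⟩
  · refine (pi_norm_le_iff_of_nonneg zero_le_one).mpr fun p => ?_
    rcases lt_trichotomy (x p) 0 with h | h | h <;> simp [h]
  · exact Finset.sum_congr rfl fun p _ => by rw [sign_mul_self]

theorem sum_abs_occ_sub_occTrunc_le (hγ0 : 0 < M.γ) (hγ1 : M.γ < 1) (π : S → PMF A) (H : ℕ) :
    ∑ p, |M.occ π p - M.occTrunc H π p| ≤ √M.γ ^ H * momentSum √M.γ 1 := by
  obtain ⟨u, hu, h⟩ := exists_sign fun p => M.occ π p - M.occTrunc H π p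
  rw [h]
  simp only [mul_sub]
  rw [Finset.sum_sub_distrib, sum_mul_occ hγ0 hγ1, sum_mul_occTrunc]
  refine (le_abs_self _).trans ((norm_tsum_sub_sum_range_le hγ0 hγ1
    (norm_term_le hγ0 π u) H).trans (mul_le_of_le_one_left ?_ hu))
  have := momentSum_pos (Real.sqrt_pos.mpr hγ0) (by rwa [Real.sqrt_lt' one_pos, one_pow]) 1
  positivity

theorem occTrunc_nonneg (hγ0 : 0 < M.γ) (π : S → PMF A) (H : ℕ) (p : S × A) :
    0 ≤ M.occTrunc H π p := by
  simp only [occTrunc]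
  exact Finset.sum_nonneg fun t _ => by positivity

theorem occTrunc_le (hγ0 : 0 < M.γ) (hγ1 : M.γ < 1) (π : S → PMF A) (H : ℕ) (p : S × A) :
    M.occTrunc H π p ≤ momentSum M.γ 0 := by
  simp only [occTrunc]
  refine le_trans (Finset.sum_le_sum fun t _ => ?_) (sum_range_le_momentSum hγ0 hγ1 0 H)
  rw [pow_zero]
  gcongr
  exact ENNReal.toReal_le_of_le_ofReal zero_le_one (by simpa using PMF.coe_le_one _ _)

/-- The gradient of `θ ↦ 𝔼 u(s_t, a_t)`. -/
def pairGrad (M : Problem S A d m) [Nonempty A] (θ : E d) (t : ℕ) (u : S × A → ℝ) : E d :=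
  ex (M.trajLaw (M.policy θ) (t + 1)) fun τ => u (τ (Fin.last t)) • M.trajScore θ τ

/-- The gradient of `θ ↦ ⟨u, λ_H(θ)⟩`. -/
def occGradTrunc (M : Problem S A d m) [Nonempty A] (H : ℕ) (θ : E d) (u : S × A → ℝ) : E d :=
  ∑ t ∈ Finset.range H, M.γ ^ t • M.pairGrad θ t u

/-- The gradient of `θ ↦ ⟨u, λ(θ)⟩`. -/
def occGrad (M : Problem S A d m) [Nonempty A] (θ : E d) (u : S × A → ℝ) : E d :=
  ∑' t, M.γ ^ t • M.pairGrad θ t u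

variable [Nonempty A]

theorem pairGrad_add (θ : E d) (t : ℕ) (u v : S × A → ℝ) :
    M.pairGrad θ t (u + v) = M.pairGrad θ t u + M.pairGrad θ t v := by
  simp only [pairGrad, Pi.add_apply, add_smul, ex_add]

theorem PolicyRegular.hasFDerivAt_ex_pairLaw (h : M.PolicyRegular lψ Lψ) (θ : E d) (t : ℕ)
    (u : S × A → ℝ) :
    HasFDerivAt (fun θ' => ex (M.pairLaw (M.policy θ') t) u) (innerSL ℝ (M.pairGrad θ t u)) θ := by
  simp only [ex_pairLaw]
  exact (h.isScore_traj (t + 1)).hasFDerivAt_ex _ θ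

theorem PolicyRegular.norm_pairGrad_le (h : M.PolicyRegular lψ Lψ) (θ : E d) (t : ℕ)
    (u : S × A → ℝ) : ‖M.pairGrad θ t u‖ ≤ ‖u‖ * (2 * lψ * ((t : ℝ) + 1)) := by
  refine norm_ex_le_const _ fun τ => ?_
  rw [norm_smul]
  have h1 := h.norm_trajScore_le θ τ
  push_cast at h1
  exact mul_le_mul (norm_le_pi_norm u _) h1 (norm_nonneg _) (norm_nonneg _)

/-- A trajectory of length t + 1 has score at most 2lψ(t + 1), which enters squared, and a score
Lipschitz constant linear in t + 1. Hence the quadratic weight, and `momentSum M.γ 2` after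
discounting. -/
theorem PolicyRegular.norm_pairGrad_sub_le (h : M.PolicyRegular lψ Lψ)
    (hLψ : 0 ≤ Lψ) (θ θ' : E d) (t : ℕ) (u : S × A → ℝ) :
    ‖M.pairGrad θ t u - M.pairGrad θ' t u‖ ≤
      ‖u‖ * ((6 * lψ ^ 2 + 2 * Lψ) * ((t : ℝ) + 1) ^ 2) * ‖θ - θ'‖ := by
  have h1 := (h.isScore_traj (t + 1)).norm_grad_sub_le (fun θ τ => h.norm_trajScore_le θ τ)
    (fun θ θ' τ => h.norm_trajScore_sub_le θ θ' τ)
    (f := fun τ => u (τ (Fin.last t))) (fun τ => norm_le_pi_norm u _) θ θ'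
  refine h1.trans ?_
  push_cast
  have h2 : ((t : ℝ) + 1) ≤ ((t : ℝ) + 1) ^ 2 := by nlinarith [t.cast_nonneg (α := ℝ)]
  have h3 := mul_le_mul_of_nonneg_left h2 (by positivity : 0 ≤ 2 * Lψ + 2 * lψ ^ 2)
  gcongr
  nlinarith

theorem PolicyRegular.norm_occGrad_term_le (h : M.PolicyRegular lψ Lψ) (hγ0 : 0 < M.γ)
    (θ : E d) (u : S × A → ℝ) (t : ℕ) :
    ‖M.γ ^ t • M.pairGrad θ t u‖ ≤ (2 * lψ * ‖u‖) * (M.γ ^ t * ((t : ℝ) + 1)) := by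
  rw [norm_smul, norm_pow, Real.norm_of_nonneg hγ0.le]
  have := mul_le_mul_of_nonneg_left (h.norm_pairGrad_le θ t u) (pow_nonneg hγ0.le t)
  linarith

theorem PolicyRegular.summable_occGrad (h : M.PolicyRegular lψ Lψ) (hγ0 : 0 < M.γ)
    (hγ1 : M.γ < 1) (θ : E d) (u : S × A → ℝ) :
    Summable fun t => M.γ ^ t • M.pairGrad θ t u :=
  Summable.of_norm_bounded ((summable_momentSum hγ0 hγ1 1).mul_left (2 * lψ * ‖u‖)) fun t => by
    simpa using h.norm_occGrad_term_le hγ0 θ u t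

theorem PolicyRegular.norm_occGrad_le (h : M.PolicyRegular lψ Lψ) (hγ0 : 0 < M.γ)
    (hγ1 : M.γ < 1) (θ : E d) (u : S × A → ℝ) :
    ‖M.occGrad θ u‖ ≤ 2 * lψ * momentSum M.γ 1 * ‖u‖ := by
  refine (tsum_of_norm_bounded ((summable_momentSum hγ0 hγ1 1).mul_left (2 * lψ * ‖u‖)).hasSum
    fun t => by simpa using h.norm_occGrad_term_le hγ0 θ u t).trans_eq ?_
  rw [tsum_mul_left, momentSum]
  ring

theorem PolicyRegular.occGrad_add (h : M.PolicyRegular lψ Lψ) (hγ0 : 0 < M.γ)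
    (hγ1 : M.γ < 1) (θ : E d) (u v : S × A → ℝ) :
    M.occGrad θ (u + v) = M.occGrad θ u + M.occGrad θ v := by
  simp only [occGrad, pairGrad_add, smul_add]
  exact (h.summable_occGrad hγ0 hγ1 θ u).tsum_add (h.summable_occGrad hγ0 hγ1 θ v)

theorem PolicyRegular.norm_occGrad_sub_arg_le (h : M.PolicyRegular lψ Lψ) (hγ0 : 0 < M.γ)
    (hγ1 : M.γ < 1) (θ : E d) (u v : S × A → ℝ) :
    ‖M.occGrad θ u - M.occGrad θ v‖ ≤ 2 * lψ * momentSum M.γ 1 * ‖u - v‖ := by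
  have : M.occGrad θ u = M.occGrad θ (u - v) + M.occGrad θ v := by
    rw [← h.occGrad_add hγ0 hγ1, sub_add_cancel]
  rw [this, add_sub_cancel_right]
  exact h.norm_occGrad_le hγ0 hγ1 θ _

theorem PolicyRegular.norm_occGrad_sub_le (h : M.PolicyRegular lψ Lψ)
    (hLψ : 0 ≤ Lψ) (hγ0 : 0 < M.γ) (hγ1 : M.γ < 1) (θ θ' : E d) (u : S × A → ℝ) :
    ‖M.occGrad θ u - M.occGrad θ' u‖ ≤
      (6 * lψ ^ 2 + 2 * Lψ) * momentSum M.γ 2 * ‖u‖ * ‖θ - θ'‖ := by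
  rw [occGrad, occGrad,
    ← (h.summable_occGrad hγ0 hγ1 θ u).tsum_sub (h.summable_occGrad hγ0 hγ1 θ' u)]
  refine (tsum_of_norm_bounded ((summable_momentSum hγ0 hγ1 2).mul_left
    ((6 * lψ ^ 2 + 2 * Lψ) * ‖u‖ * ‖θ - θ'‖)).hasSum fun t => ?_).trans_eq ?_
  · rw [← smul_sub, norm_smul, norm_pow, Real.norm_of_nonneg hγ0.le]
    have := mul_le_mul_of_nonneg_left (h.norm_pairGrad_sub_le hLψ θ θ' t u)
      (pow_nonneg hγ0.le t)
    linarith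
  · rw [tsum_mul_left, momentSum]
    ring

theorem PolicyRegular.norm_occGrad_sub_occGradTrunc_le (h : M.PolicyRegular lψ Lψ)
    (hγ0 : 0 < M.γ) (hγ1 : M.γ < 1) (θ : E d) (u : S × A → ℝ) (H : ℕ) :
    ‖M.occGrad θ u - M.occGradTrunc H θ u‖ ≤
      2 * lψ * ‖u‖ * (√M.γ ^ H * momentSum √M.γ 1) :=
  norm_tsum_sub_sum_range_le hγ0 hγ1 (h.norm_occGrad_term_le hγ0 θ u) H

/-- Termwise differentiation of the discounted series: the derivatives are dominated, uniformly in
θ, by the summable 2lψ‖u‖γ^t(t + 1). -/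
theorem PolicyRegular.hasFDerivAt_sum_mul_occ (h : M.PolicyRegular lψ Lψ) (hγ0 : 0 < M.γ)
    (hγ1 : M.γ < 1) (θ : E d) (u : S × A → ℝ) :
    HasFDerivAt (fun θ' => ∑ p, u p * M.occ (M.policy θ') p) (innerSL ℝ (M.occGrad θ u)) θ := by
  simp only [sum_mul_occ hγ0 hγ1]
  rw [occGrad, ContinuousLinearMap.map_tsum _ (h.summable_occGrad hγ0 hγ1 θ u)]
  have hs : Summable fun t => M.γ ^ t * ex (M.pairLaw (M.policy θ) t) u :=
    summable_term hγ0 hγ1 _ u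
  refine hasFDerivAt_tsum (f := fun t θ' => M.γ ^ t * ex (M.pairLaw (M.policy θ') t) u)
    (f' := fun t θ' => innerSL ℝ (M.γ ^ t • M.pairGrad θ' t u))
    ((summable_momentSum hγ0 hγ1 1).mul_left (2 * lψ * ‖u‖))
    (fun t θ' => ?_) (fun t θ' => ?_) (x₀ := θ) hs θ
  · rw [map_smul]
    exact (h.hasFDerivAt_ex_pairLaw θ' t u).const_mul _
  · rw [innerSL_apply_norm, pow_one]
    exact h.norm_occGrad_term_le hγ0 θ' u t

theorem PolicyRegular.sum_abs_occ_sub_le (h : M.PolicyRegular lψ Lψ) (hlψ : 0 ≤ lψ)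
    (hγ0 : 0 < M.γ) (hγ1 : M.γ < 1) (θ θ' : E d) :
    ∑ p, |M.occ (M.policy θ) p - M.occ (M.policy θ') p| ≤
      2 * lψ * momentSum M.γ 1 * ‖θ - θ'‖ := by
  obtain ⟨u, hu, hs⟩ := exists_sign fun p => M.occ (M.policy θ) p - M.occ (M.policy θ') p
  have hm := momentSum_pos hγ0 hγ1 1
  have h1 := abs_sub_le_of_hasFDerivAt (fun θ => h.hasFDerivAt_sum_mul_occ hγ0 hγ1 θ u)
    (fun θ => (h.norm_occGrad_le hγ0 hγ1 θ u).trans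
      (mul_le_of_le_one_right (by positivity) hu)) θ θ'
  rw [hs]
  simp only [mul_sub]
  rw [Finset.sum_sub_distrib]
  exact (le_abs_self _).trans h1

end Occupancy

/-! ### Gradient and smoothness of the objective -/

section Objective

variable [Nonempty A] {lF LF LF₁ : ℝ}

/-- The policy gradient theorem for a general utility. -/
theorem hasGradientAt_objective (h : M.PolicyRegular lψ Lψ) (hF : M.UtilityRegular lF LF LF₁)
    (hγ0 : 0 < M.γ) (hγ1 : M.γ < 1) (θ : E d) :
    HasGradientAt M.objective
      (M.occGrad θ (WithLp.ofLp (gradient M.F (M.occ (M.policy θ))))) θ := by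
  classical
  set g := gradient M.F (M.occ (M.policy θ)) with hg
  have hFd : HasFDerivAt M.F (InnerProductSpace.toDual ℝ _ g) (M.occ (M.policy θ)) :=
    (hF.differentiableAt _ (Or.inl ⟨_, rfl⟩)).hasGradientAt.hasFDerivAt
  have hocc : ∀ p, HasFDerivAt (fun θ' => M.occ (M.policy θ') p)
      (innerSL ℝ (M.occGrad θ (Pi.single p 1))) θ := fun p => by
    have := h.hasFDerivAt_sum_mul_occ hγ0 hγ1 θ (Pi.single p 1)
    simpa [Pi.single_apply] using this
  have hocc' : DifferentiableAt ℝ (fun θ' => M.occ (M.policy θ')) θ :=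
    differentiableAt_euclidean.mpr fun p => (hocc p).differentiableAt
  have hcomp := hFd.comp θ hocc'.hasFDerivAt
  have hlin := h.hasFDerivAt_sum_mul_occ hγ0 hγ1 θ (WithLp.ofLp g)
  have hlin2 := (innerSL ℝ g).hasFDerivAt.comp θ hocc'.hasFDerivAt
  have he : (fun θ' => ∑ p, g p * M.occ (M.policy θ') p) =
      (innerSL ℝ g) ∘ fun θ' => M.occ (M.policy θ') := by
    funext θ'
    simp [PiLp.inner_apply, mul_comm]
  rw [he] at hlin
  -- The chain rule leaves the pairing of the fixed vector `g` with the derivative of the occupancy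
  -- measure. That pairing is also the derivative of a linear functional already computed, so
  -- uniqueness of derivatives identifies it.
  have huniq := hlin2.unique hlin
  exact hcomp.congr_fderiv huniq

theorem gradient_objective (h : M.PolicyRegular lψ Lψ) (hF : M.UtilityRegular lF LF LF₁)
    (hγ0 : 0 < M.γ) (hγ1 : M.γ < 1) (θ : E d) :
    gradient M.objective θ =
      M.occGrad θ (WithLp.ofLp (gradient M.F (M.occ (M.policy θ)))) :=
  (hasGradientAt_objective h hF hγ0 hγ1 θ).gradient

theorem norm_gradient_objective_le (h : M.PolicyRegular lψ Lψ)
    (hF : M.UtilityRegular lF LF LF₁) (hlψ : 0 ≤ lψ) (hγ0 : 0 < M.γ) (hγ1 : M.γ < 1) (θ : E d) :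
    ‖gradient M.objective θ‖ ≤ 2 * lψ * momentSum M.γ 1 * lF := by
  rw [gradient_objective h hF hγ0 hγ1]
  have hm := momentSum_pos hγ0 hγ1 1
  refine (h.norm_occGrad_le hγ0 hγ1 θ _).trans ?_
  gcongr
  exact hF.grad_le _ ⟨_, rfl⟩

theorem norm_gradient_occ_sub_le (h : M.PolicyRegular lψ Lψ)
    (hF : M.UtilityRegular lF LF LF₁) (hlψ : 0 ≤ lψ) (hLF₁ : 0 ≤ LF₁) (hγ0 : 0 < M.γ)
    (hγ1 : M.γ < 1) (θ θ' : E d) :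
    ‖WithLp.ofLp (gradient M.F (M.occ (M.policy θ)) - gradient M.F (M.occ (M.policy θ')))‖ ≤
      LF₁ * (2 * lψ * momentSum M.γ 1) * ‖θ - θ'‖ := by
  refine (hF.lipschitz_one _ (Or.inl ⟨_, rfl⟩) _ (Or.inl ⟨_, rfl⟩)).trans ?_
  rw [mul_assoc]
  exact mul_le_mul_of_nonneg_left (h.sum_abs_occ_sub_le hlψ hγ0 hγ1 θ θ') hLF₁

/-- The Lipschitz constant of the gradient of the objective. -/
def smoothConst (γ lψ Lψ lF LF₁ : ℝ) : ℝ :=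
  LF₁ * (2 * lψ * momentSum γ 1) ^ 2 + (6 * lψ ^ 2 + 2 * Lψ) * momentSum γ 2 * lF

theorem norm_gradient_objective_sub_le (h : M.PolicyRegular lψ Lψ)
    (hF : M.UtilityRegular lF LF LF₁) (hlψ : 0 ≤ lψ) (hLψ : 0 ≤ Lψ) (hLF₁ : 0 ≤ LF₁)
    (hγ0 : 0 < M.γ) (hγ1 : M.γ < 1) (θ θ' : E d) :
    ‖gradient M.objective θ - gradient M.objective θ'‖ ≤
      smoothConst M.γ lψ Lψ lF LF₁ * ‖θ - θ'‖ := by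
  rw [gradient_objective h hF hγ0 hγ1, gradient_objective h hF hγ0 hγ1]
  set u := WithLp.ofLp (gradient M.F (M.occ (M.policy θ)))
  set v := WithLp.ofLp (gradient M.F (M.occ (M.policy θ')))
  have hm := momentSum_pos hγ0 hγ1 1
  have hm2 := momentSum_pos hγ0 hγ1 2
  have h1 := norm_sub_le_norm_sub_add_norm_sub (M.occGrad θ u) (M.occGrad θ v) (M.occGrad θ' v)
  have h2 := h.norm_occGrad_sub_arg_le hγ0 hγ1 θ u v
  have h3 := h.norm_occGrad_sub_le hLψ hγ0 hγ1 θ θ' v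
  have h4 : ‖u - v‖ ≤ LF₁ * (2 * lψ * momentSum M.γ 1) * ‖θ - θ'‖ :=
    norm_gradient_occ_sub_le h hF hlψ hLF₁ hγ0 hγ1 θ θ'
  have h5 : ‖v‖ ≤ lF := hF.grad_le _ ⟨_, rfl⟩
  have h6 := mul_le_mul_of_nonneg_left h4 (by positivity : 0 ≤ 2 * lψ * momentSum M.γ 1)
  have h7 : (6 * lψ ^ 2 + 2 * Lψ) * momentSum M.γ 2 * ‖v‖ * ‖θ - θ'‖ ≤
      (6 * lψ ^ 2 + 2 * Lψ) * momentSum M.γ 2 * lF * ‖θ - θ'‖ := by gcongr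
  rw [smoothConst]
  linarith

/-- The mean value inequality on the segment, after subtracting the linear part. It yields the
smoothness constant without the usual factor 1/2, which only affects the step size bound. -/
theorem objective_ge (h : M.PolicyRegular lψ Lψ)
    (hF : M.UtilityRegular lF LF LF₁) (hlψ : 0 ≤ lψ) (hLψ : 0 ≤ Lψ) (hlF : 0 ≤ lF)
    (hLF₁ : 0 ≤ LF₁) (hγ0 : 0 < M.γ) (hγ1 : M.γ < 1) (θ v : E d) :
    M.objective θ + inner ℝ (gradient M.objective θ) v -
      smoothConst M.γ lψ Lψ lF LF₁ * ‖v‖ ^ 2 ≤ M.objective (θ + v) := by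
  have hm := momentSum_pos hγ0 hγ1 1
  have hm2 := momentSum_pos hγ0 hγ1 2
  have hd : ∀ x, HasFDerivAt M.objective (innerSL ℝ (gradient M.objective x)) x := fun x => by
    rw [gradient_objective h hF hγ0 hγ1]
    exact hasGradientAt_objective h hF hγ0 hγ1 x
  have hC : 0 ≤ smoothConst M.γ lψ Lψ lF LF₁ := by unfold smoothConst; positivity
  have hseg : ∀ x ∈ segment ℝ θ (θ + v), ‖x - θ‖ ≤ ‖v‖ := fun x hx => by
    obtain ⟨b, hb, rfl⟩ := (segment_eq_image' ℝ θ (θ + v)).subset hx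
    simp only [add_sub_cancel_left, norm_smul]
    refine mul_le_of_le_one_left (norm_nonneg _) ?_
    rw [Real.norm_of_nonneg hb.1]
    exact hb.2
  have h1 := (convex_segment (𝕜 := ℝ) θ (θ + v)).norm_image_sub_le_of_norm_hasFDerivWithin_le'
    (f := M.objective) (φ := innerSL ℝ (gradient M.objective θ))
    (C := smoothConst M.γ lψ Lψ lF LF₁ * ‖v‖)
    (fun x _ => (hd x).hasFDerivWithinAt)
    (fun x hx => by
      rw [← map_sub, innerSL_apply_norm]
      exact (norm_gradient_objective_sub_le h hF hlψ hLψ hLF₁ hγ0 hγ1 x θ).trans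
        (mul_le_mul_of_nonneg_left (hseg x hx) hC))
    (left_mem_segment ℝ _ _) (right_mem_segment ℝ _ _)
  rw [add_sub_cancel_left, innerSL_apply_apply] at h1
  have h2 := neg_le_of_abs_le h1
  nlinarith

end Objective

/-! ### Mean and size of the policy gradient estimate -/

section Estimates

/-- Exchanging the sums turns rewards-to-go into each reward times the score of the trajectory up to
it. In this form the estimate grows by one term per time step, allowing induction on the horizon. -/
theorem pgEstimate_eq {H : ℕ} (τ : Fin H → S × A) (θ : E d) (r : EuclideanSpace ℝ (S × A)) :
    M.pgEstimate τ θ r = ∑ h : Fin H, ∑ t : Fin H,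
      if t ≤ h then (M.γ ^ (h : ℕ) * r (τ h)) • M.score θ (τ t).1 (τ t).2 else 0 := by
  rw [Finset.sum_comm, pgEstimate]
  refine Finset.sum_congr rfl fun t _ => ?_
  rw [Finset.sum_smul, ← Finset.sum_filter]
  refine Finset.sum_congr (by ext; simp) fun _ _ => rfl

theorem pgEstimate_succ {H : ℕ} (τ : Fin (H + 1) → S × A) (θ : E d)
    (r : EuclideanSpace ℝ (S × A)) :
    M.pgEstimate τ θ r = M.pgEstimate (Fin.init τ) θ r +
      M.γ ^ H • (r (τ (Fin.last H)) • M.trajScore θ τ) := by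
  rw [pgEstimate_eq, Fin.sum_univ_castSucc, pgEstimate_eq]
  congr 1
  · refine Finset.sum_congr rfl fun h _ => ?_
    rw [Fin.sum_univ_castSucc, if_neg (by simp), add_zero]
    rfl
  · simp only [Fin.le_last, if_true, Fin.val_last, ← Finset.smul_sum, mul_smul]
    rfl

variable [Nonempty A]

theorem ex_pgEstimate (H : ℕ) (θ : E d) (r : EuclideanSpace ℝ (S × A)) :
    (ex (M.trajLaw (M.policy θ) H) fun τ => M.pgEstimate τ θ r) =
      M.occGradTrunc H θ (WithLp.ofLp r) := by
  induction H with
  | zero => simp [trajLaw, ex_pure, pgEstimate, occGradTrunc]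
  | succ H ih =>
    simp only [pgEstimate_succ]
    rw [ex_add, ex_trajLaw_init (M := M) (M.policy θ) H fun τ => M.pgEstimate τ θ r, ih, ex_smul,
      occGradTrunc, occGradTrunc, Finset.sum_range_succ]
    rfl

theorem PolicyRegular.norm_pgEstimate_le (h : M.PolicyRegular lψ Lψ) (hlψ : 0 ≤ lψ)
    (hγ0 : 0 < M.γ) (hγ1 : M.γ < 1) {H : ℕ} (τ : Fin H → S × A) (θ : E d)
    (r : EuclideanSpace ℝ (S × A)) :
    ‖M.pgEstimate τ θ r‖ ≤ 2 * lψ * momentSum M.γ 1 * ‖WithLp.ofLp r‖ := by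
  have h1 : ‖M.pgEstimate τ θ r‖ ≤ 2 * lψ * ‖WithLp.ofLp r‖ *
      ∑ t ∈ Finset.range H, M.γ ^ t * ((t : ℝ) + 1) ^ 1 := by
    induction H with
    | zero => simp [pgEstimate]
    | succ H ih =>
      rw [pgEstimate_succ, Finset.sum_range_succ, mul_add]
      refine (norm_add_le _ _).trans (add_le_add (ih _) ?_)
      rw [norm_smul, norm_smul, norm_pow, Real.norm_of_nonneg hγ0.le]
      have h2 := h.norm_trajScore_le θ τ
      have h3 := norm_le_pi_norm (WithLp.ofLp r) (τ (Fin.last H))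
      push_cast at h2
      calc _ ≤ M.γ ^ H * (‖WithLp.ofLp r‖ * (2 * lψ * ((H : ℝ) + 1))) := by gcongr
        _ = _ := by ring
  refine h1.trans ?_
  have := mul_le_mul_of_nonneg_left (sum_range_le_momentSum hγ0 hγ1 1 H)
    (by positivity : 0 ≤ 2 * lψ * ‖WithLp.ofLp r‖)
  linarith

end Estimates

end Problem

/-! ### The regression subroutine -/

/-- The constant of the `O(1/K)` bound for averaged stochastic gradient descent with step size
`1/(4B^2)`, initial distance `R` and noise level `σ`. -/
def averagedSGDConst (B μ R σ : ℝ) : ℝ :=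
  (4 * B ^ 2 * (B ^ 2 * (R ^ 2 + σ ^ 2 / (2 * μ)) + σ ^ 2) +
    4 * (1 / (2 * (1 / (8 * B ^ 2))) + B ^ 2) ^ 2 *
      ((R ^ 2 + σ ^ 2 / (2 * μ)) + R ^ 2)) / μ ^ 2

theorem averagedSGDConst_nonneg {B μ R σ : ℝ} (hμ : 0 < μ) : 0 ≤ averagedSGDConst B μ R σ := by
  unfold averagedSGDConst
  positivity

theorem euclidean_norm_le_sum_abs {ι : Type*} [Fintype ι] (x : EuclideanSpace ℝ ι) :
    ‖x‖ ≤ ∑ i, |x i| := by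
  have h0 : 0 ≤ ∑ i, |x i| := Finset.sum_nonneg fun i _ => abs_nonneg _
  refine abs_le_of_sq_le_sq' ?_ h0 |>.2
  rw [EuclideanSpace.norm_sq_eq]
  exact Finset.sum_sq_le_sq_sum_of_nonneg fun i _ => abs_nonneg _

namespace Problem

variable {S A : Type*} [Fintype S] [Fintype A] {d m : ℕ} {M : Problem S A d m} 

section MonteCarlo

variable [DecidableEq S] [DecidableEq A]

theorem mcOcc_eq {H : ℕ} (τ : Fin H → S × A) (p : S × A) :
    M.mcOcc τ p = ∑ h : Fin H, M.γ ^ (h : ℕ) * if τ h = p then (1 : ℝ) else 0 := by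
  simp [mcOcc]

theorem abs_mcOcc_le (hγ0 : 0 < M.γ) (hγ1 : M.γ < 1) {H : ℕ} (τ : Fin H → S × A) (p : S × A) :
    |M.mcOcc τ p| ≤ momentSum M.γ 0 := by
  refine (Finset.abs_sum_le_sum_abs _ _).trans
    (le_trans ?_ (sum_range_le_momentSum hγ0 hγ1 0 H))
  rw [← Fin.sum_univ_eq_sum_range fun t => M.γ ^ t * ((t : ℝ) + 1) ^ 0]
  refine Finset.sum_le_sum fun h _ => ?_
  rw [pow_zero, mul_one]
  split_ifs
  · rw [abs_of_pos (by positivity)]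
  · rw [abs_zero]
    positivity

theorem ex_mcOcc (π : S → PMF A) (H : ℕ) (p : S × A) :
    (ex (M.trajLaw π H) fun τ => M.mcOcc τ p) = M.occTrunc H π p := by
  simp only [mcOcc_eq]
  rw [ex_trajLaw_sum π H fun q => if q = p then (1 : ℝ) else 0]
  simp only [← toReal_eq_ex]
  rfl

end MonteCarlo

variable [Nonempty A]

section Query

theorem queryLaw_toReal (p : S × A) :
    (M.queryLaw p).toReal = (M.ρ p.1).toReal * (1 / (Fintype.card A : ℝ)) := by
  classical
  rw [toReal_eq_ex, queryLaw, ex_bind]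
  simp only [ex_bind, ex_pure]
  rw [ex_eq_sum, Finset.sum_eq_single p.1]
  · rw [ex_eq_sum, Finset.sum_eq_single p.2]
    · simp
    · intro a _ ha
      rw [if_neg fun e => ha (congrArg Prod.snd e), smul_zero]
    · simp
  · intro s _ hs
    rw [ex_eq_sum, Finset.sum_eq_zero fun a _ => by
      rw [if_neg fun e => hs (congrArg Prod.fst e), smul_zero], smul_zero]
  · simp

theorem le_queryLaw {ρmin : ℝ} (hρ : ∀ s, ρmin ≤ (M.ρ s).toReal) (p : S × A) :
    ρmin / Fintype.card A ≤ (M.queryLaw p).toReal := by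
  rw [queryLaw_toReal, mul_one_div]
  gcongr
  exact hρ _

theorem regLoss_eq_ex (H : ℕ) (θ : E d) (ω : E m) :
    M.regLoss H θ ω = ex M.queryLaw fun p =>
      (M.occTrunc H (M.policy θ) p - inner ℝ (M.φ p) ω) ^ 2 := by
  rw [ex_eq_sum]
  rfl

theorem regLoss_nonneg (H : ℕ) (θ : E d) (ω : E m) : 0 ≤ M.regLoss H θ ω := by
  rw [regLoss_eq_ex]
  exact ex_nonneg _ fun p => sq_nonneg _

/-- The normal equations of the regression problem. -/
theorem ex_residual_smul_eq_zero {H : ℕ} {θ : E d} {w : E m}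
    (hw : ∀ ω, M.regLoss H θ w ≤ M.regLoss H θ ω) :
    (ex M.queryLaw fun p =>
      (M.occTrunc H (M.policy θ) p - inner ℝ (M.φ p) w) • M.φ p) = 0 := by
  set g := ex M.queryLaw fun p => (M.occTrunc H (M.policy θ) p - inner ℝ (M.φ p) w) • M.φ p
    with hg
  set q := ex M.queryLaw fun p => inner ℝ (M.φ p) g ^ 2 with hq
  have hq0 : 0 ≤ q := ex_nonneg _ fun p => sq_nonneg _
  have h1 : ∀ t : ℝ, M.regLoss H θ (w + t • g) =
      M.regLoss H θ w - (2 * t) * ‖g‖ ^ 2 + t ^ 2 * q := fun t => by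
    have e : ∀ p, (M.occTrunc H (M.policy θ) p - inner ℝ (M.φ p) (w + t • g)) ^ 2 =
        (M.occTrunc H (M.policy θ) p - inner ℝ (M.φ p) w) ^ 2 -
          (2 * t) * inner ℝ g ((M.occTrunc H (M.policy θ) p - inner ℝ (M.φ p) w) • M.φ p) +
          t ^ 2 * inner ℝ (M.φ p) g ^ 2 := fun p => by
      rw [inner_add_right, inner_smul_right, inner_smul_right, real_inner_comm g]
      ring
    rw [regLoss_eq_ex, regLoss_eq_ex]
    simp only [e]
    rw [ex_add, ex_sub, ex_mul, ex_mul, ex_inner, ← hg, real_inner_self_eq_norm_sq]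
  have h4 : ∀ t : ℝ, 0 < t → 2 * ‖g‖ ^ 2 ≤ t * q := fun t ht => by
    have := hw (w + t • g)
    rw [h1] at this
    nlinarith
  by_contra hne
  have hpos : 0 < ‖g‖ ^ 2 := by positivity
  -- A step along `g` small enough that the linear gain beats the quadratic loss; the 1 in the
  -- denominator covers q = 0.
  have h5 := h4 (‖g‖ ^ 2 / (q + 1)) (by positivity)
  have h6 : ‖g‖ ^ 2 / (q + 1) * q ≤ ‖g‖ ^ 2 := by
    rw [div_mul_eq_mul_div, div_le_iff₀ (by linarith)]
    nlinarith
  linarith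

theorem FeatureRegular.le_ex_inner_sq {B μ : ℝ} (h : M.FeatureRegular B μ) (v : E m) :
    μ * ‖v‖ ^ 2 ≤ ex M.queryLaw fun p => inner ℝ (M.φ p) v ^ 2 := by
  have h1 := h.cov.dotProduct_mulVec_nonneg (WithLp.ofLp v)
  rw [Matrix.sub_mulVec, Matrix.sum_mulVec, dotProduct_sub, dotProduct_sum,
    Matrix.smul_mulVec, Matrix.one_mulVec, dotProduct_smul] at h1
  have h2 : star (WithLp.ofLp v) ⬝ᵥ WithLp.ofLp v = ‖v‖ ^ 2 := by
    rw [← real_inner_self_eq_norm_sq, EuclideanSpace.inner_eq_star_dotProduct, dotProduct_comm]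
  have h3 : ∀ p, star (WithLp.ofLp v) ⬝ᵥ (((M.queryLaw p).toReal •
      Matrix.vecMulVec (WithLp.ofLp (M.φ p)) (WithLp.ofLp (M.φ p))).mulVec (WithLp.ofLp v)) =
        (M.queryLaw p).toReal • inner ℝ (M.φ p) v ^ 2 := fun p => by
    have : inner ℝ (M.φ p) v = WithLp.ofLp (M.φ p) ⬝ᵥ WithLp.ofLp v := by
      rw [EuclideanSpace.inner_eq_star_dotProduct, dotProduct_comm, star_trivial]
    rw [Matrix.smul_mulVec, Matrix.vecMulVec_mulVec, dotProduct_smul, dotProduct_smul, this,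
      star_trivial, dotProduct_comm (WithLp.ofLp v)]
    simp [sq]
  simp only [h2, h3] at h1
  rw [ex_eq_sum]
  simpa using h1

/-- The joint law of the query and the trajectory of an iteration of the regression. -/
def sampleLaw (M : Problem S A d m) (H : ℕ) (θ : E d) : PMF ((S × A) × (Fin H → S × A)) :=
  M.queryLaw.bind fun p => (M.trajLaw (M.policy θ) H).bind fun τ => PMF.pure (p, τ)

theorem ex_sampleLaw {V : Type*} [NormedAddCommGroup V] [NormedSpace ℝ V] (H : ℕ) (θ : E d)
    (f : (S × A) × (Fin H → S × A) → V) :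
    ex (M.sampleLaw H θ) f =
      ex M.queryLaw fun p => ex (M.trajLaw (M.policy θ) H) fun τ => f (p, τ) := by
  rw [sampleLaw]
  simp only [ex_bind, ex_pure]

end Query

section Regression

variable [DecidableEq S] [DecidableEq A]

instance finSupp_sgdLaw (ω₀ : E m) (β : ℝ) (H : ℕ) (θ : E d) : ∀ k, FinSupp (M.sgdLaw ω₀ β H θ k)
  | 0 => FinSupp.pure _
  | k + 1 => by
    have := finSupp_sgdLaw ω₀ β H θ k
    unfold sgdLaw
    infer_instance

instance finSupp_sgdOutput (ω₀ : E m) (β : ℝ) (K H : ℕ) (θ : E d) : FinSupp (M.sgdOutput ω₀ β K H θ) := by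
  unfold sgdOutput
  infer_instance

/-- Recentering at an arbitrary `w` puts the recursion in abstract least squares form. The factor 2
of the gradient moves into the step size η = 2β, and the count H + 1 is one query plus a trajectory.
-/
theorem sgdLaw_succ (ω₀ : E m) (β : ℝ) (H : ℕ) (θ : E d) (w : E m) (k : ℕ) :
    M.sgdLaw ω₀ β H θ (k + 1) = (M.sgdLaw ω₀ β H θ k).bind fun x =>
      (M.sampleLaw H θ).bind fun z => PMF.pure (lsStep (fun z => M.φ z.1)
        (fun z => M.mcOcc z.2 z.1 - inner ℝ (M.φ z.1) w) w (2 * β) (H + 1) x z) := by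
  rw [sgdLaw]
  congr 1
  funext x
  simp only [sampleLaw, PMF.bind_bind, PMF.pure_bind]
  congr 1
  funext p
  congr 1
  funext τ
  have : β • (2 * (inner ℝ (M.φ p) x.iterate - M.mcOcc τ p)) • M.φ p =
      (2 * β) • residualGrad (fun z : (S × A) × (Fin H → S × A) => M.φ z.1)
        (fun z => M.mcOcc z.2 z.1 - inner ℝ (M.φ z.1) w) (x.iterate - w) (p, τ) := by
    rw [residualGrad, smul_smul, smul_smul, inner_sub_right]
    congr 1
    ring
  simp only [lsStep, this]

/-- The averaged SGD subroutine approximates the minimizer of the regression loss. -/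
theorem ex_sgdOutput_sub_sq_le {B μ : ℝ} (hφ : ∀ p, ‖M.φ p‖ ≤ B) (hB : 0 < B)
    (hμ0 : 0 < μ) (hμB : μ ≤ B ^ 2)
    (hμ : ∀ v : E m, μ * ‖v‖ ^ 2 ≤ ex M.queryLaw fun p => inner ℝ (M.φ p) v ^ 2)
    (hγ0 : 0 < M.γ) (hγ1 : M.γ < 1) {H : ℕ} {θ : E d} {w : E m}
    (hw : ∀ ω, M.regLoss H θ w ≤ M.regLoss H θ ω) {K : ℕ} (hK : 1 ≤ K) :
    (ex (M.sgdOutput 0 (1 / (8 * B ^ 2)) K H θ) fun y => ‖y.1 - w‖ ^ 2) ≤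
      averagedSGDConst B μ (B * momentSum M.γ 0 / μ)
        (momentSum M.γ 0 + B * (B * momentSum M.γ 0 / μ)) / K := by
  have hm := momentSum_pos hγ0 hγ1 0
  set R := B * momentSum M.γ 0 / μ with hR
  have hnormal := ex_residual_smul_eq_zero hw
  have hμ' : ∀ v : E m, μ * ‖v‖ ^ 2 ≤
      ex (M.sampleLaw H θ) fun z => inner ℝ (M.φ z.1) v ^ 2 := fun v => by
    rw [ex_sampleLaw]
    simp only [ex_const]
    exact hμ v
  have hξ : (ex (M.sampleLaw H θ) fun z =>
      (M.mcOcc z.2 z.1 - inner ℝ (M.φ z.1) w) • M.φ z.1) = 0 := by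
    rw [ex_sampleLaw, ← hnormal]
    refine ex_congr _ fun p => ?_
    have := ex_clm (M.trajLaw (M.policy θ) H)
      ((ContinuousLinearMap.id ℝ ℝ).smulRight (M.φ p))
      fun τ => M.mcOcc τ p - inner ℝ (M.φ p) w
    simp only [ContinuousLinearMap.smulRight_apply, ContinuousLinearMap.id_apply] at this
    rw [this, ex_sub, ex_const, ex_mcOcc]
  -- The normal equations express the covariance operator at `w` as a mean of occupancies times
  -- features; inverting it gives a bound on `w` independent of θ and H.
  have hwR : ‖w‖ ≤ R := by
    have h1 := le_norm_secondMoment_apply M.queryLaw M.φ hμ w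
    have h2 : secondMoment M.queryLaw M.φ w =
        ex M.queryLaw fun p => M.occTrunc H (M.policy θ) p • M.φ p := by
      simp only [sub_smul] at hnormal
      rw [ex_sub, sub_eq_zero] at hnormal
      rw [secondMoment_apply, hnormal]
    have h3 : ‖secondMoment M.queryLaw M.φ w‖ ≤ momentSum M.γ 0 * B := by
      rw [h2]
      refine norm_ex_le_const _ fun p => ?_
      rw [norm_smul, Real.norm_of_nonneg (occTrunc_nonneg hγ0 _ _ _)]
      exact mul_le_mul (occTrunc_le hγ0 hγ1 _ _ _) (hφ p) (norm_nonneg _) hm.le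
    rw [hR, le_div_iff₀ hμ0]
    linarith
  have hσ : ∀ z : (S × A) × (Fin H → S × A),
      |M.mcOcc z.2 z.1 - inner ℝ (M.φ z.1) w| ≤ momentSum M.γ 0 + B * R := fun z => by
    refine (abs_sub _ _).trans (add_le_add (abs_mcOcc_le hγ0 hγ1 _ _) ?_)
    exact (abs_real_inner_le_norm _ _).trans
      (mul_le_mul (hφ _) hwR (norm_nonneg _) hB.le)
  have hηB : 2 * (1 / (8 * B ^ 2)) * B ^ 2 ≤ 1 / 4 := by
    apply le_of_eq
    field_simp
    norm_num
  have hp0 : M.sgdLaw 0 (1 / (8 * B ^ 2)) H θ 0 = PMF.pure ⟨0, 0, 0⟩ := rfl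
  have key := ex_average_sub_sq_le (p := M.sgdLaw 0 (1 / (8 * B ^ 2)) H θ)
    (D := M.sampleLaw H θ) (a := fun z => M.φ z.1)
    (ξ := fun z => M.mcOcc z.2 z.1 - inner ℝ (M.φ z.1) w) (w := w)
    (η := 2 * (1 / (8 * B ^ 2))) (c := H + 1)
    (fun z => hφ z.1) hσ hξ hμ' hμ0 hμB (by positivity) hηB hwR hp0
    (sgdLaw_succ 0 (1 / (8 * B ^ 2)) H θ w) hK
  rw [sgdOutput, ex_map]
  exact key

/-- The averaged SGD subroutine approximates the truncated occupancy measure. -/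
theorem ex_sgdOutput_linApprox_sub_sq_le {B μ ρmin : ℝ} (hφ : M.FeatureRegular B μ) (hB : 0 < B)
    (hμ0 : 0 < μ) (hρ0 : 0 < ρmin) (hρ : ∀ s, ρmin ≤ (M.ρ s).toReal)
    (hγ0 : 0 < M.γ) (hγ1 : M.γ < 1) {H : ℕ} {θ : E d} {w : E m}
    (hw : ∀ ω, M.regLoss H θ w ≤ M.regLoss H θ ω) {K : ℕ} (hK : 1 ≤ K) :
    (ex (M.sgdOutput 0 (1 / (8 * B ^ 2)) K H θ) fun y =>
        ‖M.linApprox y.1 - M.occTrunc H (M.policy θ)‖ ^ 2) ≤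
      Fintype.card A / ρmin * (2 * M.regLoss H θ w + 2 * B ^ 2 *
        (averagedSGDConst B (min μ (B ^ 2)) (B * momentSum M.γ 0 / min μ (B ^ 2))
          (momentSum M.γ 0 + B * (B * momentSum M.γ 0 / min μ (B ^ 2))) / K)) := by
  have hcard : (0 : ℝ) < Fintype.card A := by exact_mod_cast Fintype.card_pos
  have h1 : ∀ y : E m × ℕ, ‖M.linApprox y.1 - M.occTrunc H (M.policy θ)‖ ^ 2 ≤
      Fintype.card A / ρmin * (2 * M.regLoss H θ w + 2 * B ^ 2 * ‖y.1 - w‖ ^ 2) := fun y => by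
    have h2 : ρmin / Fintype.card A * ‖M.linApprox y.1 - M.occTrunc H (M.policy θ)‖ ^ 2 ≤
        M.regLoss H θ y.1 := by
      rw [EuclideanSpace.norm_sq_eq, Finset.mul_sum, regLoss]
      refine Finset.sum_le_sum fun p _ => ?_
      have : ‖(M.linApprox y.1 - M.occTrunc H (M.policy θ)) p‖ ^ 2 =
          (M.occTrunc H (M.policy θ) p - inner ℝ (M.φ p) y.1) ^ 2 := by
        rw [Real.norm_eq_abs, sq_abs, PiLp.sub_apply, linApprox]
        ring
      rw [this]
      exact mul_le_mul_of_nonneg_right (le_queryLaw hρ p) (sq_nonneg _)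
    have h3 : M.regLoss H θ y.1 ≤ 2 * M.regLoss H θ w + 2 * B ^ 2 * ‖y.1 - w‖ ^ 2 := by
      rw [regLoss_eq_ex, regLoss_eq_ex, ← ex_mul, ← ex_const M.queryLaw
        (2 * B ^ 2 * ‖y.1 - w‖ ^ 2), ← ex_add]
      refine ex_mono _ fun p => ?_
      have e : inner ℝ (M.φ p) y.1 = inner ℝ (M.φ p) w + inner ℝ (M.φ p) (y.1 - w) := by
        rw [← inner_add_right, add_sub_cancel]
      have h4 : inner ℝ (M.φ p) (y.1 - w) ^ 2 ≤ B ^ 2 * ‖y.1 - w‖ ^ 2 := by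
        rw [← mul_pow, ← sq_abs]
        refine pow_le_pow_left₀ (abs_nonneg _) ((abs_real_inner_le_norm _ _).trans ?_) 2
        exact mul_le_mul_of_nonneg_right (hφ.norm_le p) (norm_nonneg _)
      rw [e]
      nlinarith [sq_nonneg (M.occTrunc H (M.policy θ) p - inner ℝ (M.φ p) w +
        inner ℝ (M.φ p) (y.1 - w))]
    have h5 := h2.trans h3
    rw [div_mul_eq_mul_div, div_le_iff₀ hcard] at h5
    rw [div_mul_eq_mul_div, le_div_iff₀ hρ0]
    linarith
  refine (ex_mono _ h1).trans ?_
  rw [ex_mul, ex_add, ex_const, ex_mul]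
  -- For m = 0 the covariance condition is vacuous and μ may exceed B². The minimum restores the
  -- inequality needed for the contraction factor to be nonnegative.
  have hmin : 0 < min μ (B ^ 2) := lt_min hμ0 (by positivity)
  have h6 := ex_sgdOutput_sub_sq_le hφ.norm_le hB hmin (min_le_right _ _)
    (fun v => (mul_le_mul_of_nonneg_right (min_le_left _ _) (sq_nonneg _)).trans
      (hφ.le_ex_inner_sq v)) hγ0 hγ1 hw hK
  gcongr

/-- The bound for the mean squared error of the estimate of `∇F(λ(θ))`, given the approximation
error `e`, the number `K` of regression steps and `q = √γ ^ H`. -/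
def utilityGradBound (γ LF nA ρmin B μ e K q : ℝ) : ℝ :=
  2 * LF ^ 2 * (nA / ρmin * (2 * e + 2 * B ^ 2 *
    (averagedSGDConst B (min μ (B ^ 2)) (B * momentSum γ 0 / min μ (B ^ 2))
      (momentSum γ 0 + B * (B * momentSum γ 0 / min μ (B ^ 2))) / K)) +
    (q * momentSum √γ 1) ^ 2)

theorem ex_sgdOutput_gradient_sub_sq_le {B μ ρmin lF LF LF₁ : ℝ} (hφ : M.FeatureRegular B μ)
    (hF : M.UtilityRegular lF LF LF₁) (hB : 0 < B)
    (hμ0 : 0 < μ) (hρ0 : 0 < ρmin) (hρ : ∀ s, ρmin ≤ (M.ρ s).toReal)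
    (hγ0 : 0 < M.γ) (hγ1 : M.γ < 1) {H : ℕ} {θ : E d} {w : E m}
    (hw : ∀ ω, M.regLoss H θ w ≤ M.regLoss H θ ω) {K : ℕ} (hK : 1 ≤ K) :
    (ex (M.sgdOutput 0 (1 / (8 * B ^ 2)) K H θ) fun y =>
        ‖WithLp.ofLp (gradient M.F (M.linApprox y.1) -
          gradient M.F (M.occ (M.policy θ)))‖ ^ 2) ≤
      utilityGradBound M.γ LF (Fintype.card A) ρmin B μ (M.regLoss H θ w) K (√M.γ ^ H) := by
  have h0 : ‖M.occTrunc H (M.policy θ) - M.occ (M.policy θ)‖ ≤ √M.γ ^ H * momentSum √M.γ 1 := by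
    rw [norm_sub_rev]
    exact (euclidean_norm_le_sum_abs _).trans (sum_abs_occ_sub_occTrunc_le hγ0 hγ1 _ _)
  have h1 : ∀ y : E m × ℕ, ‖WithLp.ofLp (gradient M.F (M.linApprox y.1) -
      gradient M.F (M.occ (M.policy θ)))‖ ^ 2 ≤
      (2 * LF ^ 2) * ‖M.linApprox y.1 - M.occTrunc H (M.policy θ)‖ ^ 2 +
        2 * LF ^ 2 * (√M.γ ^ H * momentSum √M.γ 1) ^ 2 := fun y => by
    have h2 := hF.lipschitz_two (M.linApprox y.1) (Or.inr ⟨_, rfl⟩) (M.occ (M.policy θ))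
      (Or.inl ⟨_, rfl⟩)
    have h3 := norm_sub_le_norm_sub_add_norm_sub (M.linApprox y.1) (M.occTrunc H (M.policy θ))
      (M.occ (M.policy θ))
    have h4 := pow_le_pow_left₀ (norm_nonneg _) h2 2
    have h5 := pow_le_pow_left₀ (norm_nonneg _) h3 2
    have h6 := pow_le_pow_left₀ (norm_nonneg _) h0 2
    have h7 : ‖M.linApprox y.1 - M.occ (M.policy θ)‖ ^ 2 ≤
        2 * ‖M.linApprox y.1 - M.occTrunc H (M.policy θ)‖ ^ 2 +
          2 * (√M.γ ^ H * momentSum √M.γ 1) ^ 2 := by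
      nlinarith [sq_nonneg (‖M.linApprox y.1 - M.occTrunc H (M.policy θ)‖ -
        ‖M.occTrunc H (M.policy θ) - M.occ (M.policy θ)‖)]
    rw [mul_pow] at h4
    nlinarith [mul_le_mul_of_nonneg_left h7 (sq_nonneg LF)]
  refine (ex_mono _ h1).trans ?_
  rw [ex_add, ex_mul, ex_const, utilityGradBound]
  have h8 := ex_sgdOutput_linApprox_sub_sq_le hφ hB hμ0 hρ0 hρ hγ0 hγ1 hw hK
  rw [mul_add]
  gcongr

end Regression

end Problem

/-! ### One ascent step: estimation error and potential -/

/-- The bound on the error of the policy gradient estimate, in units of the squared error of the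
utility gradient. -/
def errConst (γ lψ : ℝ) : ℝ :=
  8 * ((2 * lψ * momentSum √γ 1) ^ 2 + (2 * lψ * momentSum γ 1) ^ 2)

/-- The bound on the truncation error and on the sampling variance of the policy gradient
estimate, for a batch of `N` trajectories and `q = √γ ^ H`. -/
def batchError (γ lψ lF N q : ℝ) : ℝ :=
  8 * lF ^ 2 * (2 * lψ * momentSum √γ 1) ^ 2 * q ^ 2 +
    4 * (2 * lψ * momentSum γ 1) ^ 2 * lF ^ 2 / N

theorem momentSum_sqrt_pos {γ : ℝ} (hγ0 : 0 < γ) (hγ1 : γ < 1) (k : ℕ) : 0 < momentSum √γ k :=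
  momentSum_pos (Real.sqrt_pos.mpr hγ0) (by rwa [Real.sqrt_lt' one_pos, one_pow]) k

theorem errConst_nonneg (γ lψ : ℝ) : 0 ≤ errConst γ lψ := by
  unfold errConst
  positivity

namespace Problem

variable {S A : Type*} [Fintype S] [Fintype A] {d m : ℕ} {M : Problem S A d m}
  {lψ Lψ lF LF LF₁ : ℝ} [Nonempty A]

/-- The distance, in sup norm, from `r` to `∇F(λ(θ))`. -/
def utilityError (M : Problem S A d m) (θ : E d) (r : EuclideanSpace ℝ (S × A)) : ℝ :=
  ‖WithLp.ofLp (r - gradient M.F (M.occ (M.policy θ)))‖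

section OneStep

theorem norm_occGradTrunc_sub_gradient_sq_le (h : M.PolicyRegular lψ Lψ)
    (hF : M.UtilityRegular lF LF LF₁) (hγ0 : 0 < M.γ) (hγ1 : M.γ < 1)
    (H : ℕ) (θ : E d) (r : EuclideanSpace ℝ (S × A)) :
    ‖M.occGradTrunc H θ (WithLp.ofLp r) - gradient M.objective θ‖ ^ 2 ≤
      2 * (2 * lψ * momentSum √M.γ 1 * √M.γ ^ H) ^ 2 * ‖WithLp.ofLp r‖ ^ 2 +
        2 * (2 * lψ * momentSum M.γ 1) ^ 2 * M.utilityError θ r ^ 2 := by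
  rw [gradient_objective h hF hγ0 hγ1]
  set g := WithLp.ofLp (gradient M.F (M.occ (M.policy θ)))
  have h1 := h.norm_occGrad_sub_occGradTrunc_le hγ0 hγ1 θ (WithLp.ofLp r) H
  rw [norm_sub_rev] at h1
  have h2 : ‖M.occGrad θ (WithLp.ofLp r) - M.occGrad θ g‖ ≤
      2 * lψ * momentSum M.γ 1 * M.utilityError θ r :=
    h.norm_occGrad_sub_arg_le hγ0 hγ1 θ (WithLp.ofLp r) g
  have h3 := norm_sub_le_norm_sub_add_norm_sub (M.occGradTrunc H θ (WithLp.ofLp r))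
    (M.occGrad θ (WithLp.ofLp r)) (M.occGrad θ g)
  set X := 2 * lψ * momentSum √M.γ 1 * √M.γ ^ H * ‖WithLp.ofLp r‖ with hX
  set Y := 2 * lψ * momentSum M.γ 1 * M.utilityError θ r with hY
  have h4 : ‖M.occGradTrunc H θ (WithLp.ofLp r) - M.occGrad θ g‖ ≤ X + Y := by
    rw [hX]
    linarith
  have h5 := pow_le_pow_left₀ (norm_nonneg _) h4 2
  have h6 : (X + Y) ^ 2 ≤ 2 * X ^ 2 + 2 * Y ^ 2 := by nlinarith [sq_nonneg (X - Y)]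
  refine h5.trans (h6.trans_eq ?_)
  rw [hX, hY]
  ring

/-- The gradient of F is bounded only on Λ, and the fitted occupancy may lie far from Λ, so `r` has
no uniform bound. Its size is controlled through its own error instead. -/
theorem norm_sq_le_utilityError (hF : M.UtilityRegular lF LF LF₁) (θ : E d)
    (r : EuclideanSpace ℝ (S × A)) :
    ‖WithLp.ofLp r‖ ^ 2 ≤ 2 * lF ^ 2 + 2 * M.utilityError θ r ^ 2 := by
  have h1 := hF.grad_le _ ⟨M.policy θ, rfl⟩
  have h2 : ‖WithLp.ofLp r‖ ≤ M.utilityError θ r +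
      ‖WithLp.ofLp (gradient M.F (M.occ (M.policy θ)))‖ := by
    have := norm_add_le (WithLp.ofLp (r - gradient M.F (M.occ (M.policy θ))))
      (WithLp.ofLp (gradient M.F (M.occ (M.policy θ))))
    rwa [← WithLp.ofLp_add, sub_add_cancel] at this
  have h3 := pow_le_pow_left₀ (norm_nonneg _) (h2.trans (add_le_add_right h1 _)) 2
  nlinarith [sq_nonneg (M.utilityError θ r - lF)]

/-- The mean squared error of the policy gradient estimate. -/
theorem ex_estimate_sub_gradient_sq_le (h : M.PolicyRegular lψ Lψ)
    (hF : M.UtilityRegular lF LF LF₁) (hlψ : 0 ≤ lψ) (hγ0 : 0 < M.γ) (hγ1 : M.γ < 1)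
    (H : ℕ) (θ : E d) (r : EuclideanSpace ℝ (S × A)) {N : ℕ} (hN : 1 ≤ N) :
    (ex (iid (M.trajLaw (M.policy θ) H) N) fun τ =>
        ‖(1 / (N : ℝ)) • ∑ i, M.pgEstimate (τ i) θ r - gradient M.objective θ‖ ^ 2) ≤
      errConst M.γ lψ * M.utilityError θ r ^ 2 + batchError M.γ lψ lF N (√M.γ ^ H) := by
  have hN' : (1 : ℝ) ≤ N := by exact_mod_cast hN
  refine (ex_iid_norm_mean_sub_sq_le _ (fun τ => M.pgEstimate τ θ r) _ hN).trans ?_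
  rw [ex_pgEstimate]
  have hm := momentSum_pos hγ0 hγ1 1
  have hm' := momentSum_sqrt_pos hγ0 hγ1 1
  have h1 := norm_occGradTrunc_sub_gradient_sq_le h hF hγ0 hγ1 H θ r
  have h2 := norm_sq_le_utilityError hF θ r
  have h3 : (ex (M.trajLaw (M.policy θ) H) fun τ => ‖M.pgEstimate τ θ r‖ ^ 2) ≤
      (2 * lψ * momentSum M.γ 1) ^ 2 * ‖WithLp.ofLp r‖ ^ 2 := by
    refine ex_le_const _ fun τ => ?_
    rw [← mul_pow]
    exact pow_le_pow_left₀ (norm_nonneg _) (h.norm_pgEstimate_le hlψ hγ0 hγ1 τ θ r) 2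
  have hq0 : 0 ≤ √M.γ ^ H := by positivity
  have hq1 : √M.γ ^ H ≤ 1 :=
    pow_le_one₀ (Real.sqrt_nonneg _) (Real.sqrt_le_one.mpr hγ1.le)
  set q := √M.γ ^ H
  set b := M.utilityError θ r ^ 2
  have hb : 0 ≤ b := sq_nonneg _
  rw [errConst, batchError]
  set c := 2 * lψ * momentSum M.γ 1
  set s := 2 * lψ * momentSum √M.γ 1
  have hq2 : q ^ 2 ≤ 1 := pow_le_one₀ hq0 hq1
  -- The small factors q² here and 1/N below are kept only where they multiply lF²; next to the
  -- reward error `b` they are bounded by 1, so that `errConst` depends on neither H nor N.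
  have h4 : (s * q) ^ 2 * ‖WithLp.ofLp r‖ ^ 2 ≤ s ^ 2 * (2 * lF ^ 2 * q ^ 2 + 2 * b) := by
    calc _ ≤ (s * q) ^ 2 * (2 * lF ^ 2 + 2 * b) := by gcongr
      _ = s ^ 2 * (2 * lF ^ 2 * q ^ 2 + 2 * b * q ^ 2) := by ring
      _ ≤ s ^ 2 * (2 * lF ^ 2 * q ^ 2 + 2 * b) := by
        have : 2 * b * q ^ 2 ≤ 2 * b := mul_le_of_le_one_right (by positivity) hq2
        exact mul_le_mul_of_nonneg_left (by linarith) (sq_nonneg s)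
  have h5 : 2 / N * (ex (M.trajLaw (M.policy θ) H) fun τ => ‖M.pgEstimate τ θ r‖ ^ 2) ≤
      4 * c ^ 2 * lF ^ 2 / N + 4 * c ^ 2 * b := by
    calc _ ≤ 2 / N * (c ^ 2 * (2 * lF ^ 2 + 2 * b)) := by
          gcongr
          exact h3.trans (by gcongr)
      _ = 4 * c ^ 2 * lF ^ 2 / N + 4 * c ^ 2 * b / N := by ring
      _ ≤ _ := by
          gcongr
          exact div_le_self (by positivity) hN'
  nlinarith

/-- The Lyapunov function of the policy gradient method. -/
def potential (M : Problem S A d m) (D lψ α : ℝ) (θ : E d)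
    (r : EuclideanSpace ℝ (S × A)) : ℝ :=
  D - M.objective θ + errConst M.γ lψ / 2 * α * M.utilityError θ r ^ 2

/-- The Lyapunov function along an ascent step. -/
theorem potential_step_le (h : M.PolicyRegular lψ Lψ)
    (hF : M.UtilityRegular lF LF LF₁) (hlψ : 0 ≤ lψ) (hLψ : 0 ≤ Lψ) (hlF : 0 ≤ lF)
    (hLF₁ : 0 ≤ LF₁) (hγ0 : 0 < M.γ) (hγ1 : M.γ < 1) {α : ℝ} (hα : 0 ≤ α)
    (hα1 : smoothConst M.γ lψ Lψ lF LF₁ * α ≤ 1 / 4)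
    (hα2 : errConst M.γ lψ * (LF₁ * (2 * lψ * momentSum M.γ 1)) ^ 2 * α ^ 2 ≤ 1 / 4)
    (D : ℝ) (θ g : E d) (r : EuclideanSpace ℝ (S × A)) :
    M.potential D lψ α (θ + α • g) r ≤ (D - M.objective θ -
      α / 2 * ‖gradient M.objective θ‖ ^ 2) + α / 2 * ‖g - gradient M.objective θ‖ ^ 2 +
      errConst M.γ lψ * α * M.utilityError θ r ^ 2 := by
  have h1 := objective_ge h hF hlψ hLψ hlF hLF₁ hγ0 hγ1 θ (α • g)
  rw [inner_smul_right, norm_smul, Real.norm_of_nonneg hα, mul_pow] at h1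
  have h2 := norm_sub_sq_real g (gradient M.objective θ)
  rw [real_inner_comm] at h2
  set κ := LF₁ * (2 * lψ * momentSum M.γ 1)
  have hκ := norm_gradient_occ_sub_le h hF hlψ hLF₁ hγ0 hγ1 θ (θ + α • g)
  rw [sub_add_cancel_left, norm_neg, norm_smul, Real.norm_of_nonneg hα] at hκ
  have h3 : M.utilityError (θ + α • g) r ≤ M.utilityError θ r + κ * (α * ‖g‖) := by
    refine le_trans ?_ (add_le_add_right hκ _)
    have := norm_add_le (WithLp.ofLp (r - gradient M.F (M.occ (M.policy θ))))
      (WithLp.ofLp (gradient M.F (M.occ (M.policy θ)) -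
        gradient M.F (M.occ (M.policy (θ + α • g)))))
    rwa [← WithLp.ofLp_add, sub_add_sub_cancel] at this
  have h4 : M.utilityError (θ + α • g) r ^ 2 ≤
      2 * M.utilityError θ r ^ 2 + 2 * (κ ^ 2 * α ^ 2 * ‖g‖ ^ 2) := by
    have := pow_le_pow_left₀ (norm_nonneg _) h3 2
    refine this.trans ?_
    nlinarith [sq_nonneg (M.utilityError θ r - κ * (α * ‖g‖))]
  have hW := errConst_nonneg M.γ lψ
  rw [potential]
  set W := errConst M.γ lψ
  have h5 := mul_le_mul_of_nonneg_left h4 (by positivity : 0 ≤ W / 2 * α)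
  have h6 := mul_le_mul_of_nonneg_right hα2 (by positivity : 0 ≤ α * ‖g‖ ^ 2)
  have h7 := mul_le_mul_of_nonneg_right hα1 (by positivity : 0 ≤ α * ‖g‖ ^ 2)
  have h8 := congrArg (fun y => α / 2 * y) h2
  -- Curvature and staleness cost at most (α/4)‖g‖² each, by `hα1` and `hα2`; together they cancel
  -- the (α/2)‖g‖² from polarizing α⟨∇J, g⟩.
  nlinarith

end OneStep

/-! ### The full method: sample count and telescoping -/

section Method

variable [DecidableEq S] [DecidableEq A]

theorem pgLaw_succ (θ₀ : E d) (α : ℝ) (N : ℕ) (ω₀ : E m) (β : ℝ) (K H t : ℕ) :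
    M.pgLaw θ₀ α N ω₀ β K H (t + 1) = (M.pgLaw θ₀ α N ω₀ β K H t).bind fun x =>
      (M.sgdOutput ω₀ β K H x.θ).bind fun w =>
        (iid (M.trajLaw (M.policy x.θ) H) N).bind fun τ =>
          PMF.pure ⟨x.θ + α • ((1 / (N : ℝ)) • ∑ i : Fin N, M.pgEstimate (τ i) x.θ x.r),
            gradient M.F (M.linApprox w.1), x.samples + w.2 + N * H⟩ := by
  rw [pgLaw]
  simp only [smul_smul, mul_one_div]

instance finSupp_pgLaw (θ₀ : E d) (α : ℝ) (N : ℕ) (ω₀ : E m) (β : ℝ) (K H : ℕ) :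
    ∀ t, FinSupp (M.pgLaw θ₀ α N ω₀ β K H t)
  | 0 => by
    unfold pgLaw
    infer_instance
  | t + 1 => by
    have := finSupp_pgLaw θ₀ α N ω₀ β K H t
    rw [pgLaw_succ]
    infer_instance

instance finSupp_iterateLaw (θ₀ : E d) (α : ℝ) (N : ℕ) (ω₀ : E m) (β : ℝ) (K H t : ℕ) :
    FinSupp (M.iterateLaw θ₀ α N ω₀ β K H t) := by
  unfold iterateLaw
  infer_instance

theorem ex_iterateLaw (θ₀ : E d) (α : ℝ) (N : ℕ) (ω₀ : E m) (β : ℝ) (K H t : ℕ) (f : E d → ℝ) :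
    ex (M.iterateLaw θ₀ α N ω₀ β K H t) f =
      ex (M.pgLaw θ₀ α N ω₀ β K H t) fun x => f x.θ :=
  ex_map _ _ _

theorem finSupp_uniformOfFinset {X : Type*} (s : Finset X) (hs : s.Nonempty) :
    FinSupp (PMF.uniformOfFinset s hs) :=
  ⟨by rw [PMF.support_uniformOfFinset]; exact s.finite_toSet⟩

theorem ex_uniformOfFinset {X : Type*} (s : Finset X) (hs : s.Nonempty) (f : X → ℝ) :
    ex (PMF.uniformOfFinset s hs) f = 1 / s.card * ∑ x ∈ s, f x := by
  classical
  rw [ex, tsum_eq_sum (s := s) fun x hx => by simp [hx], Finset.mul_sum]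
  refine Finset.sum_congr rfl fun x hx => ?_
  simp [hx]

instance finSupp_averageLaw (θ₀ : E d) (α : ℝ) (N : ℕ) (ω₀ : E m) (β : ℝ) (K H T : ℕ)
    (hT : 1 ≤ T) : FinSupp (M.averageLaw θ₀ α N ω₀ β K H T hT) := by
  have := finSupp_uniformOfFinset (Finset.Icc 1 T) (Finset.nonempty_Icc.mpr hT)
  unfold averageLaw
  infer_instance

theorem ex_averageLaw (θ₀ : E d) (α : ℝ) (N : ℕ) (ω₀ : E m) (β : ℝ) (K H T : ℕ)
    (hT : 1 ≤ T) (f : E d → ℝ) :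
    ex (M.averageLaw θ₀ α N ω₀ β K H T hT) f =
      1 / T * ∑ t ∈ Finset.Icc 1 T, ex (M.iterateLaw θ₀ α N ω₀ β K H t) f := by
  have := finSupp_uniformOfFinset (Finset.Icc 1 T) (Finset.nonempty_Icc.mpr hT)
  rw [averageLaw, ex_bind, ex_uniformOfFinset]
  simp

theorem sgdLaw_samples (ω₀ : E m) (β : ℝ) (H : ℕ) (θ : E d) (k : ℕ) :
    ∀ x ∈ (M.sgdLaw ω₀ β H θ k).support, x.samples = k * (H + 1) := by
  induction k with
  | zero => simp [sgdLaw]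
  | succ k ih =>
    intro x hx
    simp only [sgdLaw, PMF.mem_support_bind_iff, PMF.mem_support_pure_iff] at hx
    obtain ⟨y, hy, p, -, τ, -, rfl⟩ := hx
    simp only [ih y hy]
    ring

/-- The summand outside the factor `t` is the extra regression that produces r_{-1}. -/
theorem pgLaw_samples (θ₀ : E d) (α : ℝ) (N : ℕ) (ω₀ : E m) (β : ℝ) (K H t : ℕ) :
    ∀ x ∈ (M.pgLaw θ₀ α N ω₀ β K H t).support,
      x.samples = K * (H + 1) + t * (K * (H + 1) + N * H) := by
  have hs : ∀ θ : E d, ∀ w ∈ (M.sgdOutput ω₀ β K H θ).support, w.2 = K * (H + 1) := by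
    intro θ w hw
    simp only [sgdOutput, PMF.mem_support_map_iff] at hw
    obtain ⟨y, hy, rfl⟩ := hw
    exact sgdLaw_samples ω₀ β H θ K y hy
  induction t with
  | zero =>
    intro x hx
    simp only [pgLaw, PMF.mem_support_bind_iff, PMF.mem_support_pure_iff] at hx
    obtain ⟨w, hw, rfl⟩ := hx
    simp [hs _ w hw]
  | succ t ih =>
    intro x hx
    simp only [pgLaw, PMF.mem_support_bind_iff, PMF.mem_support_pure_iff] at hx
    obtain ⟨y, hy, w, hw, τ, -, rfl⟩ := hx
    simp only [ih y hy, hs _ w hw]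
    ring

/-- The Lyapunov function along an iteration of the method. -/
theorem ex_potential_step_le (h : M.PolicyRegular lψ Lψ)
    (hF : M.UtilityRegular lF LF LF₁) (hlψ : 0 ≤ lψ) (hLψ : 0 ≤ Lψ) (hlF : 0 ≤ lF)
    (hLF₁ : 0 ≤ LF₁) (hγ0 : 0 < M.γ) (hγ1 : M.γ < 1) {α : ℝ} (hα : 0 ≤ α)
    (hα1 : smoothConst M.γ lψ Lψ lF LF₁ * α ≤ 1 / 4)
    (hα2 : errConst M.γ lψ * (LF₁ * (2 * lψ * momentSum M.γ 1)) ^ 2 * α ^ 2 ≤ 1 / 4)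
    (D : ℝ) {N : ℕ} (hN : 1 ≤ N) (ω₀ : E m) (β : ℝ) (K H : ℕ) (θ : E d)
    (r : EuclideanSpace ℝ (S × A)) :
    (ex (M.sgdOutput ω₀ β K H θ) fun w => ex (iid (M.trajLaw (M.policy θ) H) N) fun τ =>
      M.potential D lψ α (θ + α • ((1 / (N : ℝ)) • ∑ i, M.pgEstimate (τ i) θ r))
        (gradient M.F (M.linApprox w.1))) ≤
      M.potential D lψ α θ r - α / 2 * ‖gradient M.objective θ‖ ^ 2 +
        α / 2 * batchError M.γ lψ lF N (√M.γ ^ H) +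
        errConst M.γ lψ * α * ex (M.sgdOutput ω₀ β K H θ) fun w =>
          M.utilityError θ (gradient M.F (M.linApprox w.1)) ^ 2 := by
  have h1 : ∀ w : E m × ℕ, (ex (iid (M.trajLaw (M.policy θ) H) N) fun τ =>
      M.potential D lψ α (θ + α • ((1 / (N : ℝ)) • ∑ i, M.pgEstimate (τ i) θ r))
        (gradient M.F (M.linApprox w.1))) ≤
      (D - M.objective θ - α / 2 * ‖gradient M.objective θ‖ ^ 2 +
        α / 2 * (errConst M.γ lψ * M.utilityError θ r ^ 2 +
          batchError M.γ lψ lF N (√M.γ ^ H))) +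
        errConst M.γ lψ * α * M.utilityError θ (gradient M.F (M.linApprox w.1)) ^ 2 :=
    fun w => by
      refine (ex_mono _ fun τ => potential_step_le h hF hlψ hLψ hlF hLF₁ hγ0 hγ1 hα hα1 hα2 D θ
        _ _).trans ?_
      rw [ex_add, ex_add, ex_const, ex_const, ex_mul]
      gcongr
      exact ex_estimate_sub_gradient_sq_le h hF hlψ hγ0 hγ1 H θ r hN
  refine (ex_mono _ h1).trans ?_
  rw [ex_add, ex_const, ex_mul, potential]
  -- The W in the estimation error, times α/2, is exactly the weight of the reward error in the
  -- potential, so the old error is reabsorbed without loss.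
  apply le_of_eq
  ring

/-- The averaged squared norm of the gradient along the method. -/
theorem sum_ex_norm_gradient_sq_le (h : M.PolicyRegular lψ Lψ)
    (hF : M.UtilityRegular lF LF LF₁) (hlψ : 0 ≤ lψ) (hLψ : 0 ≤ Lψ) (hlF : 0 ≤ lF)
    (hLF₁ : 0 ≤ LF₁) (hγ0 : 0 < M.γ) (hγ1 : M.γ < 1) {α : ℝ} (hα : 0 < α)
    (hα1 : smoothConst M.γ lψ Lψ lF LF₁ * α ≤ 1 / 4)
    (hα2 : errConst M.γ lψ * (LF₁ * (2 * lψ * momentSum M.γ 1)) ^ 2 * α ^ 2 ≤ 1 / 4)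
    {Δ : ℝ} (θ₀ : E d) (hΔ : ∀ θ, M.objective θ ≤ M.objective θ₀ + Δ)
    {N : ℕ} (hN : 1 ≤ N) (ω₀ : E m) (β : ℝ) (K H : ℕ) {T : ℕ} (hT : 1 ≤ T) {δ : ℝ}
    (hδ : ∀ t < T, (ex (M.pgLaw θ₀ α N ω₀ β K H t) fun x => ex (M.sgdOutput ω₀ β K H x.θ) fun w =>
      M.utilityError x.θ (gradient M.F (M.linApprox w.1)) ^ 2) ≤ δ) :
    ∑ t ∈ Finset.range T, (ex (M.pgLaw θ₀ α N ω₀ β K H t) fun x =>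
      ‖gradient M.objective x.θ‖ ^ 2) ≤
      2 * Δ / α + T * (batchError M.γ lψ lF N (√M.γ ^ H) + 3 * errConst M.γ lψ * δ) := by
  set D := M.objective θ₀ + Δ with hD
  set e := batchError M.γ lψ lF N (√M.γ ^ H)
  have hW := errConst_nonneg M.γ lψ
  have h0 : (ex (M.pgLaw θ₀ α N ω₀ β K H 0) fun x => M.potential D lψ α x.θ x.r) ≤
      Δ + errConst M.γ lψ / 2 * α * δ := by
    -- The vector r_{-1} is fitted at θ_0 itself, so the initial reward error obeys the bound for
    -- time 0.
    have h1 := hδ 0 hT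
    rw [pgLaw] at h1 ⊢
    simp only [ex_bind, ex_pure, ex_const] at h1 ⊢
    simp only [potential]
    rw [ex_add, ex_const, ex_mul, hD, add_sub_cancel_left]
    gcongr
  have hstep : ∀ n ≤ T, (ex (M.pgLaw θ₀ α N ω₀ β K H n) fun x => M.potential D lψ α x.θ x.r) +
      α / 2 * ∑ t ∈ Finset.range n, (ex (M.pgLaw θ₀ α N ω₀ β K H t) fun x =>
        ‖gradient M.objective x.θ‖ ^ 2) ≤
      Δ + errConst M.γ lψ / 2 * α * δ + n * (α / 2 * e + errConst M.γ lψ * α * δ) := by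
    intro n
    induction n with
    | zero =>
      intro _
      simpa using h0
    | succ n ih =>
      intro hn
      have ih' := ih (by omega)
      rw [pgLaw_succ, Finset.sum_range_succ]
      simp only [ex_bind, ex_pure]
      have h1 := ex_mono (M.pgLaw θ₀ α N ω₀ β K H n) fun x => ex_potential_step_le h hF hlψ hLψ
        hlF hLF₁ hγ0 hγ1 hα.le hα1 hα2 D hN ω₀ β K H x.θ x.r
      rw [ex_add, ex_add, ex_sub, ex_mul, ex_mul, ex_mul, ex_const] at h1
      have h2 := mul_le_mul_of_nonneg_left (hδ n (by omega))
        (by positivity : 0 ≤ errConst M.γ lψ * α)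
      push_cast
      linarith
  have hfin := hstep T le_rfl
  have hpos : 0 ≤ ex (M.pgLaw θ₀ α N ω₀ β K H T) fun x => M.potential D lψ α x.θ x.r :=
    ex_nonneg _ fun x => by
      rw [potential]
      have := hΔ x.θ
      have : 0 ≤ errConst M.γ lψ / 2 * α * M.utilityError x.θ x.r ^ 2 := by positivity
      linarith
  have hδ0 : 0 ≤ δ := (ex_nonneg _ fun x => ex_nonneg _ fun w => sq_nonneg _).trans (hδ 0 hT)
  have hT' : (1 : ℝ) ≤ T := by exact_mod_cast hT
  have h3 : errConst M.γ lψ / 2 * α * δ ≤ T * (errConst M.γ lψ / 2 * α * δ) :=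
    le_mul_of_one_le_left (by positivity) hT'
  set G := ∑ t ∈ Finset.range T, (ex (M.pgLaw θ₀ α N ω₀ β K H t) fun x =>
      ‖gradient M.objective x.θ‖ ^ 2)
  have h4 : α / 2 * G ≤ α / 2 * (2 * Δ / α + T * (e + 3 * errConst M.γ lψ * δ)) := by
    have : α / 2 * (2 * Δ / α + T * (e + 3 * errConst M.γ lψ * δ)) =
        Δ + T * (α / 2 * e + errConst M.γ lψ * α * δ) + T * (errConst M.γ lψ / 2 * α * δ) := by
      field_simp
      ring
    rw [this]
    linarith
  exact le_of_mul_le_mul_left h4 (by positivity)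

end Method

end Problem

/-! ### Choice of parameters and explicit constants -/

theorem sqrt_pow_le_of_mul_log_le {γ ε : ℝ} (hγ0 : 0 < γ) (hγ1 : γ < 1) (hε : 0 < ε) {H : ℕ}
    (hH : 2 / Real.log (1 / γ) * Real.log (1 / ε) ≤ H) : √γ ^ H ≤ ε := by
  have hs : 0 < √γ := Real.sqrt_pos.mpr hγ0
  have hl : 0 < Real.log (1 / γ) := Real.log_pos (by rw [lt_div_iff₀ hγ0]; linarith)
  rw [← Real.log_le_log_iff (by positivity) hε, Real.log_pow, Real.log_sqrt hγ0.le]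
  rw [div_mul_eq_mul_div, div_le_iff₀ hl] at hH
  rw [one_div, one_div, Real.log_inv, Real.log_inv] at hH
  linarith

theorem one_div_le_of_div_sq_le {c ε : ℝ} (hc : 0 < c) (hε : 0 < ε) {n : ℕ} (hn : 1 ≤ n)
    (h : c / ε ^ 2 ≤ n) : 1 / (n : ℝ) ≤ ε ^ 2 / c := by
  have hn' : (0 : ℝ) < n := by exact_mod_cast hn
  rw [div_le_iff₀ (by positivity)] at h
  rw [div_le_div_iff₀ hn' hc]
  linarith

theorem sum_Icc_le_sum_range_add (f : ℕ → ℝ) (hf : ∀ t, 0 ≤ f t) (T : ℕ) :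
    ∑ t ∈ Finset.Icc 1 T, f t ≤ ∑ t ∈ Finset.range T, f t + f T := by
  rw [← Finset.sum_range_succ]
  refine Finset.sum_le_sum_of_subset_of_nonneg (fun t ht => ?_) fun t _ _ => hf t
  simp only [Finset.mem_Icc, Finset.mem_range] at ht ⊢
  omega

/-- The coefficient of the approximation error in the error of the utility gradient. -/
def approxCoeff (LF nA ρmin : ℝ) : ℝ := 2 * LF ^ 2 * (nA / ρmin * 2)

/-- The coefficient of `ε ^ 2` in the error of the utility gradient. -/
def utilityCoeff (γ LF nA ρmin B μ c : ℝ) : ℝ :=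
  2 * LF ^ 2 * (nA / ρmin * (2 * B ^ 2 *
    (averagedSGDConst B (min μ (B ^ 2)) (B * momentSum γ 0 / min μ (B ^ 2))
      (momentSum γ 0 + B * (B * momentSum γ 0 / min μ (B ^ 2))) / c)) + momentSum √γ 1 ^ 2)

/-- The coefficient of `ε ^ 2` in the error of a batch of trajectories. -/
def batchCoeff (γ lψ lF c : ℝ) : ℝ :=
  8 * lF ^ 2 * (2 * lψ * momentSum √γ 1) ^ 2 + 4 * (2 * lψ * momentSum γ 1) ^ 2 * lF ^ 2 / c

/-- The constant of the bound for the averaged squared norm of the gradient. -/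
def gradSqConst (γ lψ lF LF α nA ρmin B μ Δ c : ℝ) : ℝ :=
  ((2 * |Δ| / α + (2 * lψ * momentSum γ 1 * lF) ^ 2) / c + batchCoeff γ lψ lF c +
    3 * errConst γ lψ * utilityCoeff γ LF nA ρmin B μ c) +
    3 * errConst γ lψ * approxCoeff LF nA ρmin

theorem approxCoeff_nonneg {LF nA ρmin : ℝ} (hnA : 0 ≤ nA) (hρ : 0 < ρmin) :
    0 ≤ approxCoeff LF nA ρmin := by
  unfold approxCoeff
  positivity

theorem utilityCoeff_nonneg {γ LF nA ρmin B μ c : ℝ} (hnA : 0 ≤ nA) (hρ : 0 < ρmin)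
    (hB : 0 < B) (hμ : 0 < μ) (hc : 0 < c) : 0 ≤ utilityCoeff γ LF nA ρmin B μ c := by
  have := averagedSGDConst_nonneg (B := B) (μ := min μ (B ^ 2))
    (R := B * momentSum γ 0 / min μ (B ^ 2))
    (σ := momentSum γ 0 + B * (B * momentSum γ 0 / min μ (B ^ 2)))
    (lt_min hμ (by positivity))
  unfold utilityCoeff
  positivity

theorem batchCoeff_nonneg {γ lψ lF c : ℝ} (hc : 0 < c) : 0 ≤ batchCoeff γ lψ lF c := by
  unfold batchCoeff
  positivity

theorem batchError_le {γ lψ lF c ε N q : ℝ} (hq0 : 0 ≤ q) (hq : q ≤ ε)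
    (hN : 1 / N ≤ ε ^ 2 / c) : batchError γ lψ lF N q ≤ batchCoeff γ lψ lF c * ε ^ 2 := by
  have hq2 : q ^ 2 ≤ ε ^ 2 := pow_le_pow_left₀ hq0 hq 2
  rw [batchError, batchCoeff, add_mul]
  refine add_le_add (by gcongr) ?_
  calc _ = 4 * (2 * lψ * momentSum γ 1) ^ 2 * lF ^ 2 * (1 / N) := by ring
    _ ≤ 4 * (2 * lψ * momentSum γ 1) ^ 2 * lF ^ 2 * (ε ^ 2 / c) := by gcongr
    _ = _ := by ring

namespace Problem

/-- The bound is affine in the approximation error, so averaging over the random θ_t requires only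
the mean of that error. -/
theorem utilityGradBound_eq (γ LF nA ρmin B μ e K q : ℝ) :
    utilityGradBound γ LF nA ρmin B μ e K q =
      approxCoeff LF nA ρmin * e + utilityGradBound γ LF nA ρmin B μ 0 K q := by
  unfold utilityGradBound approxCoeff
  ring

theorem utilityGradBound_le {γ LF nA ρmin B μ e c ε K q : ℝ} (hnA : 0 ≤ nA) (hρ : 0 < ρmin)
    (hB : 0 < B) (hμ : 0 < μ) (hq0 : 0 ≤ q) (hq : q ≤ ε) (hK : 1 / K ≤ ε ^ 2 / c) :
    utilityGradBound γ LF nA ρmin B μ e K q ≤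
      approxCoeff LF nA ρmin * e + utilityCoeff γ LF nA ρmin B μ c * ε ^ 2 := by
  have hq2 : q ^ 2 ≤ ε ^ 2 := pow_le_pow_left₀ hq0 hq 2
  have h0 := averagedSGDConst_nonneg (B := B) (μ := min μ (B ^ 2))
    (R := B * momentSum γ 0 / min μ (B ^ 2))
    (σ := momentSum γ 0 + B * (B * momentSum γ 0 / min μ (B ^ 2)))
    (lt_min hμ (by positivity))
  rw [utilityGradBound_eq, utilityGradBound, utilityCoeff]
  set a := averagedSGDConst B (min μ (B ^ 2)) (B * momentSum γ 0 / min μ (B ^ 2))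
    (momentSum γ 0 + B * (B * momentSum γ 0 / min μ (B ^ 2)))
  refine add_le_add le_rfl ?_
  calc _ = 2 * LF ^ 2 * (nA / ρmin * (2 * B ^ 2 * (a * (1 / K))) +
        q ^ 2 * momentSum √γ 1 ^ 2) := by ring
    _ ≤ 2 * LF ^ 2 * (nA / ρmin * (2 * B ^ 2 * (a * (ε ^ 2 / c))) +
        ε ^ 2 * momentSum √γ 1 ^ 2) := by gcongr
    _ = _ := by ring

variable {S A : Type*} [Fintype S] [Fintype A] {d m : ℕ} {M : Problem S A d m}
  {lψ Lψ lF LF LF₁ : ℝ} [Nonempty A] [DecidableEq S] [DecidableEq A]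

/-- The mean squared norm of the gradient at the output of the method. -/
theorem ex_averageLaw_norm_gradient_sq_le (h : M.PolicyRegular lψ Lψ)
    (hF : M.UtilityRegular lF LF LF₁) {B μ : ℝ} (hφ : M.FeatureRegular B μ)
    (hlψ : 0 ≤ lψ) (hLψ : 0 ≤ Lψ) (hlF : 0 ≤ lF)
    (hLF₁ : 0 ≤ LF₁) (hγ0 : 0 < M.γ) (hγ1 : M.γ < 1) (hB : 0 < B) (hμ0 : 0 < μ) {ρmin : ℝ}
    (hρ0 : 0 < ρmin) (hρ : ∀ s, ρmin ≤ (M.ρ s).toReal) {α : ℝ} (hα : 0 < α)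
    (hα1 : smoothConst M.γ lψ Lψ lF LF₁ * α ≤ 1 / 4)
    (hα2 : errConst M.γ lψ * (LF₁ * (2 * lψ * momentSum M.γ 1)) ^ 2 * α ^ 2 ≤ 1 / 4)
    {Δ : ℝ} (θ₀ : E d) (hΔ : ∀ θ, M.objective θ ≤ M.objective θ₀ + Δ)
    {c ε : ℝ} (hc : 0 < c) (hε : 0 < ε)
    {T N K H : ℕ} (hT : 1 ≤ T) (hN : 1 ≤ N) (hK : 1 ≤ K) (hTc : c / ε ^ 2 ≤ T)
    (hNc : c / ε ^ 2 ≤ N) (hKc : c / ε ^ 2 ≤ K) (hq : √M.γ ^ H ≤ ε)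
    {εapprox : ℝ} {ωstar : E d → E m}
    (hω : ∀ θ ω, M.regLoss H θ (ωstar θ) ≤ M.regLoss H θ ω)
    (happrox : ∀ t < T, (ex (M.iterateLaw θ₀ α N 0 (1 / (8 * B ^ 2)) K H t) fun θ =>
      M.regLoss H θ (ωstar θ)) ≤ εapprox) :
    (ex (M.averageLaw θ₀ α N 0 (1 / (8 * B ^ 2)) K H T hT) fun θ =>
      ‖gradient M.objective θ‖ ^ 2) ≤
      gradSqConst M.γ lψ lF LF α (Fintype.card A) ρmin B μ Δ c * (ε ^ 2 + εapprox) := by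
  have hnA : (0 : ℝ) ≤ Fintype.card A := Nat.cast_nonneg _
  have hT' : (0 : ℝ) < T := by exact_mod_cast hT
  have hq0 : 0 ≤ √M.γ ^ H := by positivity
  have hεa : 0 ≤ εapprox :=
    (ex_nonneg _ fun θ => regLoss_nonneg H θ (ωstar θ)).trans (happrox 0 hT)
  have hQ := approxCoeff_nonneg (LF := LF) hnA hρ0
  have hP := utilityCoeff_nonneg (γ := M.γ) (LF := LF) hnA hρ0 hB hμ0 hc
  have hW := errConst_nonneg M.γ lψ
  have hE := batchCoeff_nonneg (γ := M.γ) (lψ := lψ) (lF := lF) hc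
  have hT1 := one_div_le_of_div_sq_le hc hε hT hTc
  have hbatch := batchError_le (γ := M.γ) (lψ := lψ) (lF := lF) hq0 hq
    (one_div_le_of_div_sq_le hc hε hN hNc)
  rw [gradSqConst]
  set Q := approxCoeff LF (Fintype.card A) ρmin
  set P := utilityCoeff M.γ LF (Fintype.card A) ρmin B μ c
  set W := errConst M.γ lψ
  set b := batchCoeff M.γ lψ lF c
  have hδ : ∀ t < T, (ex (M.pgLaw θ₀ α N 0 (1 / (8 * B ^ 2)) K H t) fun x =>
      ex (M.sgdOutput 0 (1 / (8 * B ^ 2)) K H x.θ) fun w =>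
        M.utilityError x.θ (gradient M.F (M.linApprox w.1)) ^ 2) ≤ Q * εapprox + P * ε ^ 2 := by
    intro t ht
    have h1 : ∀ x : PGState S A d, (ex (M.sgdOutput 0 (1 / (8 * B ^ 2)) K H x.θ) fun w =>
        M.utilityError x.θ (gradient M.F (M.linApprox w.1)) ^ 2) ≤
        Q * M.regLoss H x.θ (ωstar x.θ) + P * ε ^ 2 := fun x =>
      (ex_sgdOutput_gradient_sub_sq_le hφ hF hB hμ0 hρ0 hρ hγ0 hγ1 (hω x.θ) hK).trans
        (utilityGradBound_le hnA hρ0 hB hμ0 hq0 hq (one_div_le_of_div_sq_le hc hε hK hKc))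
    refine (ex_mono _ h1).trans ?_
    rw [ex_add, ex_mul, ex_const]
    have h2 := happrox t ht
    rw [ex_iterateLaw] at h2
    gcongr
  have hsum := sum_ex_norm_gradient_sq_le h hF hlψ hLψ hlF hLF₁ hγ0 hγ1 hα hα1 hα2 θ₀ hΔ hN
    0 (1 / (8 * B ^ 2)) K H hT hδ
  set G := 2 * lψ * momentSum M.γ 1 * lF
  -- Telescoping covers times 0 to T - 1, while the output is drawn from 1 to T. The last iterate is
  -- covered by the a priori gradient bound, at cost G²/T.
  have hlast : (ex (M.pgLaw θ₀ α N 0 (1 / (8 * B ^ 2)) K H T) fun x =>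
      ‖gradient M.objective x.θ‖ ^ 2) ≤ G ^ 2 := by
    refine ex_le_const _ fun x => ?_
    exact pow_le_pow_left₀ (norm_nonneg _)
      (norm_gradient_objective_le h hF hlψ hγ0 hγ1 x.θ) 2
  rw [ex_averageLaw]
  simp only [ex_iterateLaw]
  have hIcc := sum_Icc_le_sum_range_add (fun t =>
    ex (M.pgLaw θ₀ α N 0 (1 / (8 * B ^ 2)) K H t) fun x => ‖gradient M.objective x.θ‖ ^ 2)
    (fun t => ex_nonneg _ fun x => sq_nonneg _) T
  have hΔ' : 2 * Δ / α ≤ 2 * |Δ| / α := by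
    gcongr
    exact le_abs_self Δ
  have hDD : 0 ≤ 2 * |Δ| / α + G ^ 2 := by positivity
  set DD := 2 * |Δ| / α + G ^ 2
  calc _ ≤ 1 / (T : ℝ) * (DD + T * (b * ε ^ 2 + 3 * W * (Q * εapprox + P * ε ^ 2))) := by
        gcongr
        have h3 := mul_le_mul_of_nonneg_left hbatch hT'.le
        refine hIcc.trans ?_
        simp only [DD]
        linarith
    _ = DD * (1 / T) + (b * ε ^ 2 + 3 * W * (Q * εapprox + P * ε ^ 2)) := by
        field_simp
    _ ≤ DD * (ε ^ 2 / c) + (b * ε ^ 2 + 3 * W * (Q * εapprox + P * ε ^ 2)) := by gcongr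
    _ = (DD / c + b + 3 * W * P) * ε ^ 2 + 3 * W * Q * εapprox := by ring
    _ ≤ (DD / c + b + 3 * W * P + 3 * W * Q) * ε ^ 2 +
        (DD / c + b + 3 * W * P + 3 * W * Q) * εapprox := by
        have h4 : 0 ≤ 3 * W * Q := by positivity
        have h5 : 0 ≤ DD / c + b + 3 * W * P := by positivity
        exact add_le_add (mul_le_mul_of_nonneg_right (le_add_of_nonneg_right h4) (sq_nonneg ε))
          (mul_le_mul_of_nonneg_right (le_add_of_nonneg_left h5) hεa)
    _ = _ := by ring

end Problem

/-! ### Sample complexity and conclusion -/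

theorem samples_le {T N K H : ℕ} (hT : 1 ≤ T) (hH : 1 ≤ H) :
    K * (H + 1) + T * (K * (H + 1) + N * H) ≤ 4 * (T * (K + N) * H) := by
  have h1 : K * (H + 1) ≤ 2 * (K * H) := by nlinarith [Nat.zero_le K]
  have h2 : K * H ≤ T * (K * H) := Nat.le_mul_of_pos_left _ hT
  have h3 := Nat.mul_le_mul_left T h1
  have h4 := Nat.zero_le (T * (N * H))
  nlinarith

theorem mul_mul_le_of_le_div_sq {c ε : ℝ} (hε : 0 < ε) {T N K H : ℕ}
    (hT : T ≤ c / ε ^ 2) (hN : N ≤ c / ε ^ 2) (hK : K ≤ c / ε ^ 2)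
    (hH : H ≤ c * Real.log (1 / ε)) :
    (T : ℝ) * (K + N) * H ≤ 2 * c ^ 3 * (1 / ε) ^ 4 * Real.log (1 / ε) := by
  have h0 : 0 ≤ c / ε ^ 2 := (Nat.cast_nonneg T).trans hT
  calc (T : ℝ) * (K + N) * H ≤
        (c / ε ^ 2) * (c / ε ^ 2 + c / ε ^ 2) * (c * Real.log (1 / ε)) := by gcongr
    _ = _ := by
      field_simp
      ring

end

end GenUtilityRL

theorem mainTheorem4
    (γ lψ Lψ lF LF LF₁ : ℝ) (hγ₀ : 0 < γ) (hγ₁ : γ < 1)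
    (hlψ : 0 < lψ) (hLψ : 0 < Lψ) (hlF : 0 < lF) (hLF : 0 < LF) (hLF₁ : 0 < LF₁) :
    -- a bound on the step size and the constant of the horizon
    ∃ α₀ > 0, ∃ cH > 0,
    ∀ (α : ℝ), 0 < α → α ≤ α₀ →
    -- the remaining constants of the problem, and the constants of the choice of `T, N, K, H`
    ∀ (nA m : ℕ) (ρmin B μ Δ c c' : ℝ), 0 < ρmin → 0 < B → 0 < μ → 0 < c → 0 < c' →
    -- the constant of all the estimates
    ∃ C > 0,
    ∀ (S A : Type*) [Fintype S] [Fintype A] [DecidableEq S] [DecidableEq A] [Nonempty A]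
      (d : ℕ) (M : Problem S A d m) (θ₀ : E d),
      M.γ = γ → Fintype.card A = nA → (∀ s, ρmin ≤ (M.ρ s).toReal) →
      M.PolicyRegular lψ Lψ → M.UtilityRegular lF LF LF₁ → M.FeatureRegular B μ →
      (∀ θ, M.objective θ ≤ M.objective θ₀ + Δ) →
      Differentiable ℝ M.objective ∧
      ∀ (ε : ℝ), 0 < ε →
      ∀ (T N K H : ℕ) (hT : 1 ≤ T), 1 ≤ N → 1 ≤ K → 1 ≤ H →
        c / ε ^ 2 ≤ T → c / ε ^ 2 ≤ N → c / ε ^ 2 ≤ K → cH * Real.log (1 / ε) ≤ H →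
        -- the gradient bound, up to the approximation error
        (∀ (εapprox : ℝ) (ωstar : E d → E m),
          (∀ θ ω, M.regLoss H θ (ωstar θ) ≤ M.regLoss H θ ω) →
          (∀ t < T, ∫ θ, M.regLoss H θ (ωstar θ)
            ∂(M.iterateLaw θ₀ α N 0 (1 / (8 * B ^ 2)) K H t).toMeasure ≤ εapprox) →
          ∫ θ, ‖gradient M.objective θ‖
            ∂(M.averageLaw θ₀ α N 0 (1 / (8 * B ^ 2)) K H T hT).toMeasure
              ≤ C * ε + C * Real.sqrt εapprox) ∧
        -- the sample complexity
        (ε ≤ 1 / 2 → T ≤ c' / ε ^ 2 → N ≤ c' / ε ^ 2 → K ≤ c' / ε ^ 2 →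
          H ≤ c' * Real.log (1 / ε) →
          (T : ℝ) * (K + N) * H ≤ C * (1 / ε) ^ 4 * Real.log (1 / ε) ∧
          ∀ x ∈ (M.pgLaw θ₀ α N 0 (1 / (8 * B ^ 2)) K H T).support,
            (x.samples : ℝ) ≤ C * (1 / ε) ^ 4 * Real.log (1 / ε)) := by
  have hm0 := momentSum_pos hγ₀ hγ₁ 1
  have hm2 := momentSum_pos hγ₀ hγ₁ 2
  have hL : 0 ≤ Problem.smoothConst γ lψ Lψ lF LF₁ := by
    unfold Problem.smoothConst
    positivity
  have hW := errConst_nonneg γ lψ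
  have hlog : 0 < Real.log (1 / γ) := Real.log_pos (by rw [lt_div_iff₀ hγ₀]; linarith)
  set L := Problem.smoothConst γ lψ Lψ lF LF₁
  set κ := LF₁ * (2 * lψ * momentSum γ 1) with hκ
  -- The three summands give Lα ≤ 1/4, Wκ²α ≤ 1/4 and α ≤ 1, the last two combining to Wκ²α² ≤ 1/4.
  -- The horizon constant has a 2 because truncation errors decay like √γ^H.
  refine ⟨1 / (4 * (L + errConst γ lψ * κ ^ 2 + 1)), by positivity, 2 / Real.log (1 / γ),
    by positivity, ?_⟩
  intro α hα hα₀ nA m ρmin B μ Δ c c' hρmin hB hμ hc hc'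
  have hWκ : 0 ≤ errConst γ lψ * κ ^ 2 := by positivity
  rw [le_div_iff₀ (by positivity)] at hα₀
  have hα1 : L * α ≤ 1 / 4 := by nlinarith [mul_nonneg hα.le hWκ, mul_nonneg hα.le hL]
  have hα2 : errConst γ lψ * κ ^ 2 * α ^ 2 ≤ 1 / 4 := by
    have h1 : α ≤ 1 := by nlinarith [mul_nonneg hα.le hWκ, mul_nonneg hα.le hL]
    have h2 : errConst γ lψ * κ ^ 2 * α ≤ 1 / 4 := by nlinarith [mul_nonneg hα.le hL]
    calc _ = (errConst γ lψ * κ ^ 2 * α) * α := by ring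
      _ ≤ errConst γ lψ * κ ^ 2 * α := mul_le_of_le_one_right (by positivity) h1
      _ ≤ _ := h2
  set C' := gradSqConst γ lψ lF LF α nA ρmin B μ Δ c with hC'
  -- √C' serves the gradient bound. In 8c'³, a 4 comes from `samples_le` and a 2 from K + N in
  -- `mul_mul_le_of_le_div_sq`.
  refine ⟨√C' + 8 * c' ^ 3, by positivity, ?_⟩
  intro S A _ _ _ _ _ d M θ₀ hMγ hnA hρ hψ hF hφ hΔ
  subst hMγ hnA
  have hgrad := Problem.hasGradientAt_objective hψ hF hγ₀ hγ₁
  refine ⟨fun θ => (hgrad θ).differentiableAt, ?_⟩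
  intro ε hε T N K H hT hN hK hH hTc hNc hKc hHc
  refine ⟨?_, ?_⟩
  · intro εapprox ωstar hω happrox
    simp only [integral_toMeasure_eq_ex] at happrox ⊢
    have hεa : 0 ≤ εapprox :=
      (ex_nonneg _ fun θ => Problem.regLoss_nonneg H θ (ωstar θ)).trans (happrox 0 hT)
    have hsq := Problem.ex_averageLaw_norm_gradient_sq_le hψ hF hφ hlψ.le hLψ.le hlF.le hLF₁.le
      hγ₀ hγ₁ hB hμ hρmin hρ hα hα1 hα2 θ₀ hΔ hc hε hT hN hK hTc hNc hKc
      (sqrt_pow_le_of_mul_log_le hγ₀ hγ₁ hε hHc) hω happrox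
    have hroot := Real.le_sqrt_of_sq_le ((sq_ex_le _ _).trans hsq)
    rw [Real.sqrt_mul' _ (by positivity)] at hroot
    have hadd : √(ε ^ 2 + εapprox) ≤ ε + √εapprox := by
      refine Real.sqrt_le_iff.mpr ⟨by positivity, ?_⟩
      nlinarith [Real.sq_sqrt hεa, mul_nonneg hε.le (Real.sqrt_nonneg εapprox)]
    have h8 : 0 ≤ 8 * c' ^ 3 := by positivity
    calc _ ≤ √C' * √(ε ^ 2 + εapprox) := hroot
      _ ≤ (√C' + 8 * c' ^ 3) * (ε + √εapprox) :=
        mul_le_mul (le_add_of_nonneg_right h8) hadd (Real.sqrt_nonneg _) (by positivity)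
      _ = _ := by ring
  · intro hε2 hT' hN' hK' hH'
    have hlogε : 0 ≤ Real.log (1 / ε) := Real.log_nonneg (by rw [le_div_iff₀ hε]; linarith)
    have hmul := mul_mul_le_of_le_div_sq hε hT' hN' hK' hH'
    have hc3 : 8 * c' ^ 3 * (1 / ε) ^ 4 * Real.log (1 / ε) ≤
        (√C' + 8 * c' ^ 3) * (1 / ε) ^ 4 * Real.log (1 / ε) := by
      gcongr
      exact le_add_of_nonneg_left (Real.sqrt_nonneg _)
    have hpos : 0 ≤ c' ^ 3 * (1 / ε) ^ 4 * Real.log (1 / ε) := by positivity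
    refine ⟨by linarith, fun x hx => ?_⟩
    rw [Problem.pgLaw_samples _ _ _ _ _ _ _ _ x hx]
    have hs : ((K * (H + 1) + T * (K * (H + 1) + N * H) : ℕ) : ℝ) ≤
        ((4 * (T * (K + N) * H) : ℕ) : ℝ) := by exact_mod_cast samples_le hT hH
    refine hs.trans ?_
    push_cast
    linarith
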